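/- Let $d\ge 1$, $s\ge 0$, $q\ge 1$ be integers, $\Omega=[0,1]^d$, and let $p\in[2,\infty)$ satisfy $q\le p\le 2q$ and $\frac sd>\frac1p-\frac1{2q}$. $\mathcal W^{s,p}(\Omega)$ is the space of $f\in L^p(\Omega)$ whose weak derivatives $D^\alpha f$, $|\alpha|\le s$, lie in $L^p(\Omega)$, with norm $\|f\|_{s,p}=\max_{|\alpha|\le s}\|D^\alpha f\|_{L^p(\Omega)}$. For $0<\underline b\le\bar b$ and $B\ge1$ let $\mathcal V(\underline b,\bar b,B,s,p)$ be the set of triples $(f,p^\circ,p^*)$ where $f\in\mathcal W^{s,p}(\Omega)$, $p^\circ$ and $p^*$ are probability densities on $\Omega$, $\underline b\le p^\circ\le\bar b$ on $\Omega$, and $w:=p^*/p^\circ\le B$ on $\Omega$. A function estimator is a family of (measurable) maps $K_n:\Omega^n\times\mathbb R^n\to\mathcal W^{s,p}(\Omega)$, $n\ge1$. Given $(f,p^\circ)$, real functions $A,k$ of $r$ and a factor $c_r$, it satisfies the oracle rate with factor $c_r$ if, for $x_1,x_2,\dots$ i.i.d. with density $p^\circ$, for all $n\ge1$ and all $r$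 with $\frac1r\in\bigl(\max\{\frac{d-sp}{pd},0\},\max\{\frac1p,\mathbf 1\{s>\frac dp\}\}\bigr]$, $$\Bigl(\mathbb E\bigl\|K_n\bigl((x_i)_{i\le n},(f(x_i))_{i\le n}\bigr)-f\bigr\|_{L^r(\Omega)}^r\Bigr)^{1/r}\le A_r(1+\log n)^{k_r}\,c_r\,n^{-\frac sd+(\frac1p-\frac1r)_+}.$$ For even $n=2m$ with $m\ge1$, let $\mathcal S=\{(x_i,f(x_i))\}_{i=1}^n$ with $x_1,\dots,x_n$ i.i.d. with density $p^\circ$, let $\hat f=K_m$ computed from the first $m$ observations, and put $$\hat H_B^q(\mathcal S)=\int_\Omega\hat f^{\,q}\,p^*\,dx+\frac2n\sum_{i=m+1}^{n}w(x_i)\bigl(f(x_i)^q-\hat f(x_i)^q\bigr),\qquad I_f^q=\int_\Omega f^q\,p^*\,dx .$$ Fix $R$, $A$ and $k$. Assume $(f,p^\circ,p^*)\in\mathcal V(\underline b,\bar b,B,s,p)$, $\|f\|_{s,p}\le R$, and that $K$ satisfies the oracle rate at $(f,p^\circ)$ with factor $c_r=\bar b$. Then $\hat H^q_B(\mathcal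 S)$ is integrable and unbiased, $\mathbb E\,\hat H_B^q(\mathcal S)=I_f^q$, and $$\mathbb E\bigl|\hat H_B^q(\mathcal S)-I_f^q\bigr|\le C(1+\log n)^{\kappa}\cdot B\cdot\bar b\cdot n^{\max\{-q(\frac sd-\frac1p)-1,\,-\frac12-\frac sd\}},$$ where $C,\kappa$ depend only on $d,s,p,q,R,A,k$ and $\bar b$ (not on $n$, $B$, $\underline b$, $f$, $p^\circ$, $p^*$ or $K$). If the oracle rate holds with factor $c_r=\bar b^{1/r}$, that is, with $\bar b$ multiplying the bound on the $r$-th moment $\mathbb E\|K_n-f\|_{L^r}^r$, then the same conclusions hold with $C,\kappa$ that depend only on $d,s,p,q,R,A,k$, and not on $\bar b$. -/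

import Mathlib

open MeasureTheory

noncomputable section

namespace CovShift

/-- The closed unit cube `Ω = [0,1]^d`. -/
def cube (d : ℕ) : Set (Fin d → ℝ) := Set.Icc 0 1

/-- Lebesgue measure on the cube. -/
def cubeMeasure (d : ℕ) : Measure (Fin d → ℝ) := volume.restrict (cube d)

/-- Classical partial derivative in the `i`-th coordinate. -/
def partialDeriv {d : ℕ} (i : Fin d) (φ : (Fin d → ℝ) → ℝ) : (Fin d → ℝ) → ℝ :=
  fun x => fderiv ℝ φ x (Pi.single i 1)

/-- `D^α φ = ∂₁^{α₁} ⋯ ∂_d^{α_d} φ` for a multi-index `α`. -/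
def multiDeriv {d : ℕ} (α : Fin d → ℕ) (φ : (Fin d → ℝ) → ℝ) : (Fin d → ℝ) → ℝ :=
  (List.finRange d).foldr (fun i ψ => (partialDeriv i)^[α i] ψ) φ

/-- `g` is the weak derivative `D^α f` of `f` on the interior of the cube. -/
def IsWeakDeriv {d : ℕ} (α : Fin d → ℕ) (f g : (Fin d → ℝ) → ℝ) : Prop :=
  ∀ φ : (Fin d → ℝ) → ℝ, ContDiff ℝ ((⊤ : ℕ∞) : WithTop ℕ∞) φ → HasCompactSupport φ →
    tsupport φ ⊆ interior (cube d) →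
    ∫ x, f x * multiDeriv α φ x ∂(cubeMeasure d) =
      (-1 : ℝ) ^ (∑ i, α i) * ∫ x, g x * φ x ∂(cubeMeasure d)

/-- Membership in the Sobolev space `W^{s,p}(Ω)`. -/
def MemSobolev {d : ℕ} (s : ℕ) (p : ℝ) (f : (Fin d → ℝ) → ℝ) : Prop :=
  MemLp f (ENNReal.ofReal p) (cubeMeasure d) ∧
    ∀ α : Fin d → ℕ, ∑ i, α i ≤ s →
      ∃ g : (Fin d → ℝ) → ℝ, MemLp g (ENNReal.ofReal p) (cubeMeasure d) ∧ IsWeakDeriv α f g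

/-- `max_{|α| ≤ s} ‖D^α f‖_{L^p(Ω)} ≤ R`, for `f` in `W^{s,p}(Ω)`. -/
def SobolevNormLE {d : ℕ} (s : ℕ) (p R : ℝ) (f : (Fin d → ℝ) → ℝ) : Prop :=
  MemSobolev s p f ∧
    ∀ α : Fin d → ℕ, ∑ i, α i ≤ s →
      ∀ g : (Fin d → ℝ) → ℝ, MemLp g (ENNReal.ofReal p) (cubeMeasure d) → IsWeakDeriv α f g →
        eLpNorm g (ENNReal.ofReal p) (cubeMeasure d) ≤ ENNReal.ofReal R

/-- `ρ` is a probability density on the cube. -/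
def IsDensity {d : ℕ} (ρ : (Fin d → ℝ) → ℝ) : Prop :=
  Measurable ρ ∧ (∀ x ∈ cube d, 0 ≤ ρ x) ∧ ∫⁻ x, ENNReal.ofReal (ρ x) ∂(cubeMeasure d) = 1

/-- The distribution on the cube with density `ρ`. -/
def law {d : ℕ} (ρ : (Fin d → ℝ) → ℝ) : Measure (Fin d → ℝ) :=
  (cubeMeasure d).withDensity (fun x => ENNReal.ofReal (ρ x))

/-- The joint law of `n` independent draws from the distribution with density `ρ`. -/
def sampleLaw {d : ℕ} (ρ : (Fin d → ℝ) → ℝ) (n : ℕ) : Measure (Fin n → (Fin d → ℝ)) :=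
  Measure.pi (fun _ : Fin n => law ρ)

/-- The likelihood ratio `w = p⋆ / p₀` of the target to the source density. -/
def ratio {d : ℕ} (p₀ pT : (Fin d → ℝ) → ℝ) (x : Fin d → ℝ) : ℝ := pT x / p₀ x

/-- The class `V(b, b', B, s, p)` of triples (function, source density, target density). -/
def InClass {d : ℕ} (s : ℕ) (p b b' B : ℝ) (f p₀ pT : (Fin d → ℝ) → ℝ) : Prop :=
  MemSobolev s p f ∧ IsDensity p₀ ∧ IsDensity pT ∧
    (∀ x ∈ cube d, b ≤ p₀ x ∧ p₀ x ≤ b') ∧ (∀ x ∈ cube d, ratio p₀ pT x ≤ B)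

/-- A function estimator: from `n` points and `n` observed values it produces a function. -/
abbrev FunEstimator (d : ℕ) : Type :=
  (n : ℕ) → (Fin n → (Fin d → ℝ)) → (Fin n → ℝ) → ((Fin d → ℝ) → ℝ)

/-- The estimator takes values in `W^{s,p}(Ω)` and is jointly measurable in the points, the
observed values and the argument of the estimated function. -/
def IsSobolevEstimator {d : ℕ} (s : ℕ) (p : ℝ) (K : FunEstimator d) : Prop :=
  ∀ n : ℕ, 1 ≤ n →
    (∀ (x : Fin n → (Fin d → ℝ)) (y : Fin n → ℝ), (∀ i, x i ∈ cube d) → MemSobolev s p (K n x y)) ∧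
    Measurable (fun t : (Fin n → (Fin d → ℝ)) × (Fin n → ℝ) × (Fin d → ℝ) => K n t.1 t.2.1 t.2.2)

/-- The exponents `r` with `1/r ∈ (max{(d-sp)/(pd), 0}, max{1/p, 1{s > d/p}}]`. -/
def AdmissibleExponent (d s : ℕ) (p r : ℝ) : Prop :=
  0 < r ∧ max (((d : ℝ) - s * p) / (p * d)) 0 < 1 / r ∧
    1 / r ≤ max (1 / p) (Set.indicator {t : ℝ | (d : ℝ) / p < t} 1 (s : ℝ))

/-- The oracle rate at `f` under source density `p₀`: for all admissible `r` and all `n ≥ 1`,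
`(E ‖K_n - f‖_{L^r}^r)^{1/r} ≤ A_r (1 + log n)^{k_r} c_r n^{-s/d + (1/p - 1/r)_+}`,
where `c_r` is the dependence on the source distribution that is displayed, `A_r` the hidden constant
and `(1 + log n)^{k_r}` the hidden logarithmic factor. -/
def OracleRate {d : ℕ} (s : ℕ) (p : ℝ) (c A k : ℝ → ℝ) (f p₀ : (Fin d → ℝ) → ℝ)
    (K : FunEstimator d) : Prop :=
  ∀ r : ℝ, AdmissibleExponent d s p r → ∀ n : ℕ, 1 ≤ n →
    (∫⁻ x, eLpNorm (fun z => K n x (fun i => f (x i)) z - f z) (ENNReal.ofReal r)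
        (cubeMeasure d) ^ r ∂(sampleLaw p₀ n)) ^ (1 / r) ≤
      ENNReal.ofReal (A r * (1 + Real.log n) ^ (k r) * c r *
        (n : ℝ) ^ (-((s : ℝ) / d) + max (1 / p - 1 / r) 0))

/-- The target moment `I_f^q = E_{X ∼ P⋆} [f(X)^q]`. -/
def moment {d : ℕ} (q : ℕ) (pT f : (Fin d → ℝ) → ℝ) : ℝ := ∫ z, f z ^ q ∂(law pT)

/-- The two-stage estimator on a sample of even size `n = m + m`: the function is estimated from the
first `m` observations, and the residual is corrected with the last `m` observations. -/
def twoStage {d : ℕ} (q : ℕ) (p₀ pT : (Fin d → ℝ) → ℝ) (K : FunEstimator d) (m : ℕ)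
    (x : Fin (m + m) → (Fin d → ℝ)) (y : Fin (m + m) → ℝ) : ℝ :=
  let fhat : (Fin d → ℝ) → ℝ :=
    K m (fun i => x (Fin.castAdd m i)) (fun i => y (Fin.castAdd m i))
  moment q pT fhat +
    2 / ((m + m : ℕ) : ℝ) * ∑ i : Fin m, ratio p₀ pT (x (Fin.natAdd m i)) *
      (y (Fin.natAdd m i) ^ q - fhat (x (Fin.natAdd m i)) ^ q)

/-- The exponent `max{-q(s/d - 1/p) - 1, -1/2 - s/d}`. -/
def rateExponent (d s q : ℕ) (p : ℝ) : ℝ :=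
  max (-(q : ℝ) * ((s : ℝ) / d - 1 / p) - 1) (-(1 / 2) - (s : ℝ) / d)

/-- With `n = m + m` noiseless observations `(x_i, f(x_i))`, the two-stage estimator is integrable and
unbiased, and its mean absolute error is at most
`C (1 + log n)^κ · B · b' · n^{max{-q(s/d - 1/p) - 1, -1/2 - s/d}}`. -/
def UnbiasedWithRate {d : ℕ} (s q : ℕ) (p b' B C κ : ℝ) (f p₀ pT : (Fin d → ℝ) → ℝ)
    (K : FunEstimator d) (m : ℕ) : Prop :=
  Integrable (fun x => twoStage q p₀ pT K m x (fun i => f (x i))) (sampleLaw p₀ (m + m)) ∧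
  ∫ x, twoStage q p₀ pT K m x (fun i => f (x i)) ∂(sampleLaw p₀ (m + m)) = moment q pT f ∧
  ∫ x, |twoStage q p₀ pT K m x (fun i => f (x i)) - moment q pT f| ∂(sampleLaw p₀ (m + m)) ≤
    C * (1 + Real.log ((m + m : ℕ) : ℝ)) ^ κ *
      (B * b' * ((m + m : ℕ) : ℝ) ^ rateExponent d s q p)

end CovShift

end

/-! Conditionally on the first half of the sample, the correction term is a mean of `m` independent
copies of `w (f ^ q - fhat ^ q)`. Since `w` times the source density is the target density, its
expectation cancels the bias of the plug-in moment, and its variance is at most `B ^ 2 * b' / m`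
times the squared `L^2` norm of `f ^ q - fhat ^ q` (`twoStage_l2_bound`). It remains to bound the
mean of that squared norm.

Up to a constant, `|f ^ q - fhat ^ q|` is at most `|f| ^ (q - 1) |fhat - f| + |fhat - f| ^ q`. The
oracle rate at `r = 2q` bounds the last term and yields the first branch of the rate. For the
product, a three-term Hölder inequality uses `f` in `L^v` and the error at the exponents `r₀` and
`2q`, where `r₀` is `2` if `s > d / p` and `p` otherwise (`lintegral_pow_sub_pow_sq_le`,
`exists_holder_exponents`). So the oracle rate is used at two exponents only, which leaves two
values of `A` and `k` in the constants.

The best `v` is the critical Sobolev exponent, or infinity. Instead,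
`exists_eLpNorm_le_of_hasWeakDerivsLE` gives the embedding at relative distance `ε` from it, with
constant `(C / ε) ^ s`. For `ε` of order `1 / (1 + log m)` the loss `m ^ O(ε)` is bounded and `(C /
ε) ^ s` is only a power of the logarithm, which the statement allows.

The embedding is proved from the definition of weak derivatives. Local averages of `f` use kernels
supported inside the open cube, also near the boundary. The difference of two consecutive kernels is
a divergence of test functions, so the difference of the averages is controlled by ball integrals of
the weak gradient; these gain integrability, and the dyadic scales sum to a geometric series of size
`1 / ε`. -/

noncomputable section

namespace CovShift

open Set Filter Topology

/-! ### Smooth steps and one-dimensional bumps. -/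

/-- A smooth monotone step, equal to `0` on `(-∞, 1/4]` and to `1` on `[3/4, ∞)`. -/
def smoothStep (u : ℝ) : ℝ := Real.smoothTransition (2 * u - 1 / 2)

lemma contDiff_smoothStep : ContDiff ℝ ((⊤ : ℕ∞) : WithTop ℕ∞) smoothStep := by
  unfold smoothStep
  exact Real.smoothTransition.contDiff.comp (by fun_prop)

lemma smoothStep_of_le {u : ℝ} (h : u ≤ 1 / 4) : smoothStep u = 0 :=
  Real.smoothTransition.zero_of_nonpos (by linarith)

lemma smoothStep_of_ge {u : ℝ} (h : 3 / 4 ≤ u) : smoothStep u = 1 :=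
  Real.smoothTransition.one_of_one_le (by linarith)

lemma smoothStep_nonneg (u : ℝ) : 0 ≤ smoothStep u := Real.smoothTransition.nonneg _

lemma smoothStep_le_one (u : ℝ) : smoothStep u ≤ 1 := Real.smoothTransition.le_one _

lemma monotone_smoothStep : Monotone smoothStep := fun _ _ h =>
  Real.smoothTransition.monotone (by linarith)

lemma deriv_smoothStep_of_lt {u : ℝ} (h : u < 1 / 4) : deriv smoothStep u = 0 := by
  have : smoothStep =ᶠ[𝓝 u] fun _ => 0 := by
    filter_upwards [Iio_mem_nhds h] with v hv using smoothStep_of_le (le_of_lt hv)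
  rw [this.deriv_eq, deriv_const]

lemma deriv_smoothStep_of_gt {u : ℝ} (h : 3 / 4 < u) : deriv smoothStep u = 0 := by
  have : smoothStep =ᶠ[𝓝 u] fun _ => 1 := by
    filter_upwards [Ioi_mem_nhds h] with v hv using smoothStep_of_ge (le_of_lt hv)
  rw [this.deriv_eq, deriv_const]

lemma contDiff_deriv_smoothStep : ContDiff ℝ ((⊤ : ℕ∞) : WithTop ℕ∞) (deriv smoothStep) :=
  ((contDiff_infty_iff_deriv).1 contDiff_smoothStep).2

lemma deriv_smoothStep_nonneg (u : ℝ) : 0 ≤ deriv smoothStep u :=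
  monotone_smoothStep.deriv_nonneg

lemma exists_deriv_smoothStep_le : ∃ C : ℝ, 1 ≤ C ∧ ∀ u, deriv smoothStep u ≤ C := by
  obtain ⟨C, hC⟩ := (isCompact_Icc (a := (1 / 4 : ℝ)) (b := 3 / 4)).bddAbove_image
    (contDiff_deriv_smoothStep.continuous.continuousOn)
  refine ⟨max C 1, le_max_right _ _, fun u => ?_⟩
  by_cases h : u ∈ Icc (1 / 4 : ℝ) (3 / 4)
  · exact (hC (mem_image_of_mem _ h)).trans (le_max_left _ _)
  · rw [mem_Icc, not_and_or, not_le, not_le] at h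
    rcases h with h | h
    · rw [deriv_smoothStep_of_lt h]; positivity
    · rw [deriv_smoothStep_of_gt h]; positivity

/-- The smooth step rescaled to the subinterval `(1 - δ) a + δ [0, 1]` of `[0, 1]`. -/
def scaledStep (δ a z : ℝ) : ℝ := smoothStep ((z - (1 - δ) * a) / δ)

/-- The bump of mass one on the subinterval `(1 - δ) a + δ [0, 1]` of `[0, 1]`. -/
def scaledBump (δ a z : ℝ) : ℝ := δ⁻¹ * deriv smoothStep ((z - (1 - δ) * a) / δ)

lemma contDiff_scaledStep (δ a : ℝ) :
    ContDiff ℝ ((⊤ : ℕ∞) : WithTop ℕ∞) (scaledStep δ a) := by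
  unfold scaledStep
  exact contDiff_smoothStep.comp (by fun_prop)

lemma contDiff_scaledBump (δ a : ℝ) :
    ContDiff ℝ ((⊤ : ℕ∞) : WithTop ℕ∞) (scaledBump δ a) := by
  unfold scaledBump
  exact contDiff_const.mul (contDiff_deriv_smoothStep.comp (by fun_prop))

lemma hasDerivAt_scaledStep (δ a z : ℝ) :
    HasDerivAt (scaledStep δ a) (scaledBump δ a z) z := by
  have h1 : HasDerivAt smoothStep (deriv smoothStep ((z - (1 - δ) * a) / δ))
      ((z - (1 - δ) * a) / δ) :=
    (contDiff_smoothStep.differentiable (by simp)).differentiableAt.hasDerivAt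
  have h2 : HasDerivAt (fun z : ℝ => (z - (1 - δ) * a) / δ) (1 / δ) z :=
    ((hasDerivAt_id z).sub_const _).div_const _
  have := h1.comp z h2
  unfold scaledBump
  rw [mul_comm, ← one_div]
  exact this

lemma scaledStep_of_le {δ a z : ℝ} (hδ : 0 < δ) (h : z ≤ (1 - δ) * a + δ / 4) :
    scaledStep δ a z = 0 :=
  smoothStep_of_le (by rw [div_le_iff₀ hδ]; linarith)

lemma scaledStep_of_ge {δ a z : ℝ} (hδ : 0 < δ) (h : (1 - δ) * a + 3 * δ / 4 ≤ z) :
    scaledStep δ a z = 1 :=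
  smoothStep_of_ge (by rw [le_div_iff₀ hδ]; linarith)

lemma scaledBump_of_lt {δ a z : ℝ} (hδ : 0 < δ) (h : z < (1 - δ) * a + δ / 4) :
    scaledBump δ a z = 0 := by
  rw [scaledBump, deriv_smoothStep_of_lt (by rw [div_lt_iff₀ hδ]; linarith), mul_zero]

lemma scaledBump_of_gt {δ a z : ℝ} (hδ : 0 < δ) (h : (1 - δ) * a + 3 * δ / 4 < z) :
    scaledBump δ a z = 0 := by
  rw [scaledBump, deriv_smoothStep_of_gt (by rw [lt_div_iff₀ hδ]; linarith), mul_zero]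

lemma scaledBump_nonneg {δ : ℝ} (hδ : 0 < δ) (a z : ℝ) : 0 ≤ scaledBump δ a z :=
  mul_nonneg (inv_nonneg.2 hδ.le) (deriv_smoothStep_nonneg _)

lemma integral_scaledBump {δ : ℝ} (hδ : 0 < δ) (a : ℝ) : ∫ z, scaledBump δ a z = 1 := by
  have hsupp : HasCompactSupport (scaledBump δ a) := by
    refine HasCompactSupport.intro (isCompact_Icc (a := (1 - δ) * a + δ / 4)
      (b := (1 - δ) * a + 3 * δ / 4)) fun z hz => ?_
    rw [mem_Icc, not_and_or, not_le, not_le] at hz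
    exact hz.elim (scaledBump_of_lt hδ) (scaledBump_of_gt hδ)
  have h0 : Tendsto (scaledStep δ a) atBot (𝓝 0) := by
    refine tendsto_const_nhds.congr' ?_
    filter_upwards [eventually_le_atBot ((1 - δ) * a + δ / 4)] with z hz
    exact (scaledStep_of_le hδ hz).symm
  have h1 : Tendsto (scaledStep δ a) atTop (𝓝 1) := by
    refine tendsto_const_nhds.congr' ?_
    filter_upwards [eventually_ge_atTop ((1 - δ) * a + 3 * δ / 4)] with z hz
    exact (scaledStep_of_ge hδ hz).symm
  rw [integral_of_hasDerivAt_of_tendsto (hasDerivAt_scaledStep δ a)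
    ((contDiff_scaledBump δ a).continuous.integrable_of_hasCompactSupport hsupp) h0 h1, sub_zero]

/-- The support interval of the bump lies in `[δ/4, 1 - δ/4]`. -/
lemma bump_interval {δ a : ℝ} (hδ1 : δ ≤ 1) (ha : a ∈ Icc (0 : ℝ) 1) :
    δ / 4 ≤ (1 - δ) * a + δ / 4 ∧ (1 - δ) * a + 3 * δ / 4 ≤ 1 - δ / 4 := by
  have h1 : 0 ≤ (1 - δ) * a := mul_nonneg (by linarith) ha.1
  have h2 : (1 - δ) * a ≤ (1 - δ) * 1 := mul_le_mul_of_nonneg_left ha.2 (by linarith)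
  constructor <;> linarith

/-- The bump is not centred at `a`, because it is pushed into the cube, but it stays within distance
`δ` of `a`; the product kernels are therefore supported in a ball about their base point. -/
lemma bump_interval' {δ a : ℝ} (hδ : 0 < δ) (ha : a ∈ Icc (0 : ℝ) 1) :
    a - δ ≤ (1 - δ) * a + δ / 4 ∧ (1 - δ) * a + 3 * δ / 4 ≤ a + δ := by
  have h1 : 0 ≤ δ * a := mul_nonneg hδ.le ha.1
  have h2 : δ * a ≤ δ * 1 := mul_le_mul_of_nonneg_left ha.2 hδ.le
  constructor <;> nlinarith

/-! ### Test functions of product form. -/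

section ProductTest

variable {d : ℕ}

lemma contDiff_prod_coord {G : Fin d → ℝ → ℝ}
    (hG : ∀ i, ContDiff ℝ ((⊤ : ℕ∞) : WithTop ℕ∞) (G i)) :
    ContDiff ℝ ((⊤ : ℕ∞) : WithTop ℕ∞) (fun z : Fin d → ℝ => ∏ i, G i (z i)) :=
  contDiff_prod fun i _ => (hG i).comp (contDiff_apply ℝ ℝ i)

lemma isCompact_box (lo hi : ℝ) :
    IsCompact (Icc (fun _ => lo : Fin d → ℝ) (fun _ => hi)) := isCompact_Icc

lemma prod_coord_eq_zero {G : Fin d → ℝ → ℝ} {lo hi : ℝ}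
    (h : ∀ i z, z ∉ Icc lo hi → G i z = 0) {z : Fin d → ℝ}
    (hz : z ∉ Icc (fun _ => lo : Fin d → ℝ) (fun _ => hi)) : ∏ i, G i (z i) = 0 := by
  have : ∃ i, z i ∉ Icc lo hi := by
    by_contra hcon
    push Not at hcon
    exact hz ⟨fun i => (hcon i).1, fun i => (hcon i).2⟩
  obtain ⟨i, hi⟩ := this
  exact Finset.prod_eq_zero (Finset.mem_univ i) (h i _ hi)

lemma hasCompactSupport_prod_coord {G : Fin d → ℝ → ℝ} {lo hi : ℝ}
    (h : ∀ i z, z ∉ Icc lo hi → G i z = 0) :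
    HasCompactSupport (fun z : Fin d → ℝ => ∏ i, G i (z i)) :=
  HasCompactSupport.intro (isCompact_box lo hi) fun _ hz => prod_coord_eq_zero h hz

lemma tsupport_prod_coord_subset {G : Fin d → ℝ → ℝ} {lo hi : ℝ} (hlo : 0 < lo) (hhi : hi < 1)
    (h : ∀ i z, z ∉ Icc lo hi → G i z = 0) :
    tsupport (fun z : Fin d → ℝ => ∏ i, G i (z i)) ⊆ interior (cube d) := by
  have h1 : tsupport (fun z : Fin d → ℝ => ∏ i, G i (z i)) ⊆
      Icc (fun _ => lo : Fin d → ℝ) (fun _ => hi) := by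
    refine closure_minimal (fun z hz => ?_) isClosed_Icc
    by_contra hcon
    exact hz (prod_coord_eq_zero h hcon)
  refine h1.trans (fun z hz => ?_)
  have hopen : IsOpen (Set.pi univ (fun _ : Fin d => Ioo (0 : ℝ) 1)) :=
    isOpen_set_pi finite_univ fun _ _ => isOpen_Ioo
  refine interior_maximal ?_ hopen (show z ∈ _ from ?_)
  · intro y hy
    exact ⟨fun i => (hy i trivial).1.le, fun i => (hy i trivial).2.le⟩
  · intro i _
    exact ⟨hlo.trans_le (hz.1 i), (hz.2 i).trans_lt hhi⟩

lemma partialDeriv_prod_coord {G : Fin d → ℝ → ℝ}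
    (hG : ∀ i, ContDiff ℝ ((⊤ : ℕ∞) : WithTop ℕ∞) (G i)) (i : Fin d) (z : Fin d → ℝ) :
    partialDeriv i (fun z : Fin d → ℝ => ∏ j, G j (z j)) z =
      (∏ j ∈ Finset.univ.erase i, G j (z j)) * deriv (G i) (z i) := by
  have h : ∀ j ∈ (Finset.univ : Finset (Fin d)), HasFDerivAt (fun z : Fin d → ℝ => G j (z j))
      (deriv (G j) (z j) • ContinuousLinearMap.proj (R := ℝ) (φ := fun _ : Fin d => ℝ) j) z := by
    intro j _
    have h1 : HasDerivAt (G j) (deriv (G j) (z j)) (z j) :=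
      ((hG j).differentiable (by simp)).differentiableAt.hasDerivAt
    exact h1.comp_hasFDerivAt z (hasFDerivAt_apply j z)
  have := HasFDerivAt.finsetProd h
  rw [partialDeriv, this.fderiv]
  simp only [_root_.sum_apply, _root_.smul_apply,
    ContinuousLinearMap.proj_apply, smul_eq_mul]
  rw [Finset.sum_eq_single i]
  · simp
  · intro j _ hj
    simp [Pi.single_eq_of_ne hj]
  · simp

lemma multiDeriv_of_foldr_eq {α : Fin d → ℕ} (φ : (Fin d → ℝ) → ℝ) (l : List (Fin d))
    (h : ∀ i ∈ l, α i = 0) : l.foldr (fun i ψ => (partialDeriv i)^[α i] ψ) φ = φ := by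
  induction l with
  | nil => rfl
  | cons a l ih =>
    rw [List.foldr_cons, ih (fun i hi => h i (List.mem_cons_of_mem _ hi)),
      h a List.mem_cons_self]
    rfl

lemma multiDeriv_zero (φ : (Fin d → ℝ) → ℝ) : multiDeriv 0 φ = φ :=
  multiDeriv_of_foldr_eq φ _ fun _ _ => rfl

end ProductTest

/-! ### From weak derivatives of higher order to first-order ones. -/

section WeakDerivatives

variable {d : ℕ}

lemma contDiff_partialDeriv {φ : (Fin d → ℝ) → ℝ}
    (hφ : ContDiff ℝ ((⊤ : ℕ∞) : WithTop ℕ∞) φ) (i : Fin d) :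
    ContDiff ℝ ((⊤ : ℕ∞) : WithTop ℕ∞) (partialDeriv i φ) := by
  unfold partialDeriv
  exact (hφ.fderiv_right (m := ((⊤ : ℕ∞) : WithTop ℕ∞)) (by simp)).clm_apply contDiff_const

lemma partialDeriv_comm {φ : (Fin d → ℝ) → ℝ}
    (hφ : ContDiff ℝ ((⊤ : ℕ∞) : WithTop ℕ∞) φ) (i j : Fin d) :
    partialDeriv i (partialDeriv j φ) = partialDeriv j (partialDeriv i φ) := by
  have key : ∀ i j : Fin d, ∀ x, partialDeriv i (partialDeriv j φ) x =
      fderiv ℝ (fderiv ℝ φ) x (Pi.single i 1) (Pi.single j 1) := by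
    intro i j x
    have hd : DifferentiableAt ℝ (fderiv ℝ φ) x :=
      ((hφ.fderiv_right (m := ((⊤ : ℕ∞) : WithTop ℕ∞)) (by simp)).differentiable
        (by simp)).differentiableAt
    have := hd.hasFDerivAt.clm_apply (hasFDerivAt_const (Pi.single j (1 : ℝ) : Fin d → ℝ) x)
    unfold partialDeriv
    rw [this.fderiv]
    simp
  have hsymm : ∀ x, IsSymmSndFDerivAt ℝ φ x := fun x =>
    (hφ.contDiffAt).isSymmSndFDerivAt (by rw [minSmoothness_of_isRCLikeNormedField]; exact WithTop.coe_le_coe.2 le_top)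
  funext x
  rw [key, key]
  exact hsymm x _ _

lemma contDiff_iterate_partialDeriv {φ : (Fin d → ℝ) → ℝ}
    (hφ : ContDiff ℝ ((⊤ : ℕ∞) : WithTop ℕ∞) φ) (i : Fin d) (n : ℕ) :
    ContDiff ℝ ((⊤ : ℕ∞) : WithTop ℕ∞) ((partialDeriv i)^[n] φ) := by
  induction n with
  | zero => exact hφ
  | succ n ih => rw [Function.iterate_succ_apply']; exact contDiff_partialDeriv ih i

lemma partialDeriv_iterate_comm {φ : (Fin d → ℝ) → ℝ}
    (hφ : ContDiff ℝ ((⊤ : ℕ∞) : WithTop ℕ∞) φ) (i j : Fin d) (n : ℕ) :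
    partialDeriv i ((partialDeriv j)^[n] φ) = (partialDeriv j)^[n] (partialDeriv i φ) := by
  induction n with
  | zero => rfl
  | succ n ih =>
    rw [Function.iterate_succ_apply', Function.iterate_succ_apply',
      partialDeriv_comm (contDiff_iterate_partialDeriv hφ j n), ih]

lemma contDiff_foldr_partialDeriv {φ : (Fin d → ℝ) → ℝ}
    (hφ : ContDiff ℝ ((⊤ : ℕ∞) : WithTop ℕ∞) φ) (α : Fin d → ℕ) (l : List (Fin d)) :
    ContDiff ℝ ((⊤ : ℕ∞) : WithTop ℕ∞) (l.foldr (fun i ψ => (partialDeriv i)^[α i] ψ) φ) := by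
  induction l with
  | nil => exact hφ
  | cons a l ih => exact contDiff_iterate_partialDeriv ih a _

lemma partialDeriv_foldr {φ : (Fin d → ℝ) → ℝ}
    (hφ : ContDiff ℝ ((⊤ : ℕ∞) : WithTop ℕ∞) φ) (α : Fin d → ℕ) (l : List (Fin d)) (i : Fin d) :
    partialDeriv i (l.foldr (fun i ψ => (partialDeriv i)^[α i] ψ) φ) =
      l.foldr (fun i ψ => (partialDeriv i)^[α i] ψ) (partialDeriv i φ) := by
  induction l with
  | nil => rfl
  | cons a l ih =>
    rw [List.foldr_cons, List.foldr_cons,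
      partialDeriv_iterate_comm (contDiff_foldr_partialDeriv hφ α l), ih]

lemma foldr_congr_of_notMem (α : Fin d → ℕ) (i : Fin d) (φ : (Fin d → ℝ) → ℝ)
    (l : List (Fin d)) (hi : i ∉ l) :
    l.foldr (fun j ψ => (partialDeriv j)^[(α + Pi.single i 1 : Fin d → ℕ) j] ψ) φ =
      l.foldr (fun j ψ => (partialDeriv j)^[α j] ψ) φ := by
  induction l with
  | nil => rfl
  | cons a l ih =>
    rw [List.mem_cons, not_or] at hi
    rw [List.foldr_cons, List.foldr_cons, ih hi.2]
    simp [Pi.single_eq_of_ne (Ne.symm hi.1)]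

lemma foldr_add_single {φ : (Fin d → ℝ) → ℝ}
    (hφ : ContDiff ℝ ((⊤ : ℕ∞) : WithTop ℕ∞) φ) (α : Fin d → ℕ) (i : Fin d) (l : List (Fin d))
    (hl : l.Nodup) (hi : i ∈ l) :
    l.foldr (fun j ψ => (partialDeriv j)^[(α + Pi.single i 1 : Fin d → ℕ) j] ψ) φ =
      l.foldr (fun j ψ => (partialDeriv j)^[α j] ψ) (partialDeriv i φ) := by
  induction l with
  | nil => simp at hi
  | cons a l ih =>
    rw [List.nodup_cons] at hl
    rw [List.foldr_cons, List.foldr_cons]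
    by_cases ha : i = a
    · subst ha
      rw [foldr_congr_of_notMem α i φ l hl.1, ← partialDeriv_foldr hφ]
      simp [Function.iterate_succ_apply]
    · rw [ih hl.2 ((List.mem_cons.1 hi).resolve_left ha)]
      simp [Pi.single_eq_of_ne (Ne.symm ha)]

/-- Partial derivatives of a smooth function commute, so the additional one can be moved past all
others and applied to `φ` first. -/
lemma multiDeriv_add_single {φ : (Fin d → ℝ) → ℝ}
    (hφ : ContDiff ℝ ((⊤ : ℕ∞) : WithTop ℕ∞) φ) (α : Fin d → ℕ) (i : Fin d) :
    multiDeriv (α + Pi.single i 1) φ = multiDeriv α (partialDeriv i φ) :=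
  foldr_add_single hφ α i _ (List.nodup_finRange d) (List.mem_finRange i)

/-- `g` is the weak partial derivative of `f` in the `i`-th coordinate. -/
def IsWeakPartial (i : Fin d) (f g : (Fin d → ℝ) → ℝ) : Prop :=
  ∀ φ : (Fin d → ℝ) → ℝ, ContDiff ℝ ((⊤ : ℕ∞) : WithTop ℕ∞) φ → HasCompactSupport φ →
    tsupport φ ⊆ interior (cube d) →
    ∫ x, f x * partialDeriv i φ x ∂(cubeMeasure d) = - ∫ x, g x * φ x ∂(cubeMeasure d)

/-- Test the lower derivative against `∂ᵢ φ` and the higher one against `φ`: both express the same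
integral of `f`, and the common sign cancels. This allows the Sobolev inequality to be iterated one
order at a time. -/
lemma IsWeakDeriv.isWeakPartial {α : Fin d → ℕ} {i : Fin d} {f g g' : (Fin d → ℝ) → ℝ}
    (h : IsWeakDeriv α f g) (h' : IsWeakDeriv (α + Pi.single i 1) f g') :
    IsWeakPartial i g g' := by
  intro φ hφ hc hs
  have h1 := h (partialDeriv i φ) (contDiff_partialDeriv hφ i)
    (hc.fderiv_apply (𝕜 := ℝ) _) ((tsupport_fderiv_apply_subset ℝ _).trans hs)
  have h2 := h' φ hφ hc hs
  rw [multiDeriv_add_single hφ, h1] at h2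
  have hsum : ∑ j, (α + Pi.single i 1 : Fin d → ℕ) j = ∑ j, α j + 1 := by
    simp [Finset.sum_add_distrib]
  rw [hsum, pow_succ, mul_assoc] at h2
  have := mul_left_cancel₀ (pow_ne_zero _ (by norm_num : (-1 : ℝ) ≠ 0)) h2
  rw [this]; ring

lemma isWeakDeriv_zero (f : (Fin d → ℝ) → ℝ) : IsWeakDeriv 0 f f := by
  intro φ _ _ _
  rw [multiDeriv_zero]
  simp

end WeakDerivatives

/-! ### Local averages and their differences between scales. -/

section LocalAverages

variable {d : ℕ}

/-- The product bump centred near `x`, supported inside the open cube. -/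
def avgKernel (δ : ℝ) (x z : Fin d → ℝ) : ℝ := ∏ i, scaledBump δ (x i) (z i)

/-- The local average of `f` at `x` at scale `δ`. -/
def localAvg (δ : ℝ) (f : (Fin d → ℝ) → ℝ) (x : Fin d → ℝ) : ℝ :=
  ∫ z, f z * avgKernel δ x z ∂(cubeMeasure d)

/-- The factors of the test function whose `i`-th partial derivative is the `i`-th term of the
telescoping expansion of the difference of the kernels at scales `δ` and `δ'`. -/
def mixFactor (δ δ' : ℝ) (x : Fin d → ℝ) (i l : Fin d) : ℝ → ℝ :=
  if l < i then scaledBump δ' (x l) else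
    if l = i then fun z => scaledStep δ (x l) z - scaledStep δ' (x l) z else scaledBump δ (x l)

lemma mem_cube_iff {x : Fin d → ℝ} : x ∈ cube d ↔ ∀ i, x i ∈ Icc (0 : ℝ) 1 :=
  ⟨fun h i => ⟨h.1 i, h.2 i⟩, fun h => ⟨fun i => (h i).1, fun i => (h i).2⟩⟩

lemma contDiff_mixFactor (δ δ' : ℝ) (x : Fin d → ℝ) (i l : Fin d) :
    ContDiff ℝ ((⊤ : ℕ∞) : WithTop ℕ∞) (mixFactor δ δ' x i l) := by
  unfold mixFactor
  split_ifs
  · exact contDiff_scaledBump _ _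
  · exact (contDiff_scaledStep _ _).sub (contDiff_scaledStep _ _)
  · exact contDiff_scaledBump _ _

lemma scaledBump_eq_zero {δ a z lo hi : ℝ} (hδ : 0 < δ) (hlo : lo ≤ (1 - δ) * a + δ / 4)
    (hhi : (1 - δ) * a + 3 * δ / 4 ≤ hi) (hz : z ∉ Icc lo hi) : scaledBump δ a z = 0 := by
  rw [mem_Icc, not_and_or, not_le, not_le] at hz
  exact hz.elim (fun h => scaledBump_of_lt hδ (h.trans_le hlo))
    (fun h => scaledBump_of_gt hδ (hhi.trans_lt h))

lemma mixFactor_eq_zero {δ δ' lo hi : ℝ} {x : Fin d → ℝ} {i l : Fin d} (hδ : 0 < δ) (hδ' : 0 < δ')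
    (hlo : lo ≤ (1 - δ) * x l + δ / 4) (hhi : (1 - δ) * x l + 3 * δ / 4 ≤ hi)
    (hlo' : lo ≤ (1 - δ') * x l + δ' / 4) (hhi' : (1 - δ') * x l + 3 * δ' / 4 ≤ hi) {z : ℝ}
    (hz : z ∉ Icc lo hi) : mixFactor δ δ' x i l z = 0 := by
  unfold mixFactor
  split_ifs
  · exact scaledBump_eq_zero hδ' hlo' hhi' hz
  · rw [mem_Icc, not_and_or, not_le, not_le] at hz
    rcases hz with h | h
    · simp only
      rw [scaledStep_of_le hδ (h.le.trans hlo), scaledStep_of_le hδ' (h.le.trans hlo'), sub_zero]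
    · simp only
      rw [scaledStep_of_ge hδ (hhi.trans h.le), scaledStep_of_ge hδ' (hhi'.trans h.le), sub_self]
  · exact scaledBump_eq_zero hδ hlo hhi hz

lemma prod_erase_eq_mul {M : Type*} [CommMonoid M] (i : Fin d) (F : Fin d → M) :
    ∏ j ∈ Finset.univ.erase i, F j = (∏ j with j < i, F j) * ∏ j with i < j, F j := by
  rw [← Finset.prod_union]
  · refine Finset.prod_congr ?_ fun _ _ => rfl
    ext j
    simp [lt_or_lt_iff_ne]
  · rw [Finset.disjoint_left]
    intro j hj hj'
    simp only [Finset.mem_filter, Finset.mem_univ, true_and] at hj hj'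
    exact lt_asymm hj hj'

lemma partialDeriv_mixFactor (δ δ' : ℝ) (x : Fin d → ℝ) (i : Fin d) (z : Fin d → ℝ) :
    partialDeriv i (fun z : Fin d → ℝ => ∏ l, mixFactor δ δ' x i l (z l)) z =
      (scaledBump δ (x i) (z i) - scaledBump δ' (x i) (z i)) *
        (∏ j with j < i, scaledBump δ' (x j) (z j)) * ∏ j with i < j, scaledBump δ (x j) (z j) := by
  rw [partialDeriv_prod_coord (contDiff_mixFactor δ δ' x i), prod_erase_eq_mul]
  have h0 : mixFactor δ δ' x i i = fun z => scaledStep δ (x i) z - scaledStep δ' (x i) z := by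
    simp [mixFactor]
  have hder : deriv (fun z => scaledStep δ (x i) z - scaledStep δ' (x i) z) (z i) =
      scaledBump δ (x i) (z i) - scaledBump δ' (x i) (z i) :=
    ((hasDerivAt_scaledStep δ (x i) (z i)).sub (hasDerivAt_scaledStep δ' (x i) (z i))).deriv
  rw [h0, hder]
  have h1 : ∏ j with j < i, mixFactor δ δ' x i j (z j) =
      ∏ j with j < i, scaledBump δ' (x j) (z j) := by
    refine Finset.prod_congr rfl fun j hj => ?_
    simp only [Finset.mem_filter, Finset.mem_univ, true_and] at hj
    simp [mixFactor, hj]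
  have h2 : ∏ j with i < j, mixFactor δ δ' x i j (z j) =
      ∏ j with i < j, scaledBump δ (x j) (z j) := by
    refine Finset.prod_congr rfl fun j hj => ?_
    simp only [Finset.mem_filter, Finset.mem_univ, true_and] at hj
    simp [mixFactor, hj.not_gt, hj.ne']
  rw [h1, h2]
  ring

/-- Telescoping replaces the factors one at a time. Each resulting difference of bumps is the
derivative of a difference of steps, which has compact support because both steps go from `0` to
`1`. Hence the difference of the kernels is a divergence of admissible test functions. -/
lemma avgKernel_sub (δ δ' : ℝ) (x z : Fin d → ℝ) :
    avgKernel δ x z - avgKernel δ' x z =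
      ∑ i, partialDeriv i (fun z : Fin d → ℝ => ∏ l, mixFactor δ δ' x i l (z l)) z := by
  simp_rw [partialDeriv_mixFactor]
  have := Finset.prod_sub_ordered Finset.univ (fun i => scaledBump δ (x i) (z i))
    (fun i => scaledBump δ (x i) (z i) - scaledBump δ' (x i) (z i))
  simp only [sub_sub_cancel] at this
  unfold avgKernel
  rw [this]
  ring

lemma abs_scaledBump_le {C : ℝ} (hC : ∀ u, deriv smoothStep u ≤ C) {δ : ℝ} (hδ : 0 < δ)
    (a z : ℝ) : |scaledBump δ a z| ≤ C / δ := by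
  rw [abs_of_nonneg (scaledBump_nonneg hδ a z), scaledBump, div_eq_inv_mul C]
  exact mul_le_mul_of_nonneg_left (hC _) (inv_nonneg.2 hδ.le)

/-- The `i`-th factor is a difference of two functions with values in `[0, 1]`, so only `d - 1`
factors cost `1 / δ'`. The power saved against the bound of the kernel itself is what one derivative
gains. -/
lemma abs_prod_mixFactor_le {C : ℝ} (hC : ∀ u, deriv smoothStep u ≤ C) {δ δ' : ℝ} (hδ' : 0 < δ')
    (h : δ' ≤ δ) (x : Fin d → ℝ) (i : Fin d) (z : Fin d → ℝ) :
    |∏ l, mixFactor δ δ' x i l (z l)| ≤ (C / δ') ^ (d - 1) := by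
  have hC0 : 0 ≤ C := (deriv_smoothStep_nonneg 0).trans (hC 0)
  have hle : C / δ ≤ C / δ' := div_le_div_of_nonneg_left hC0 hδ' h
  rw [Finset.abs_prod, ← Finset.mul_prod_erase _ _ (Finset.mem_univ i)]
  have h1 : |mixFactor δ δ' x i i (z i)| ≤ 1 := by
    have e : mixFactor δ δ' x i i = fun z => scaledStep δ (x i) z - scaledStep δ' (x i) z := by
      simp [mixFactor]
    rw [e, abs_le]
    have a1 := smoothStep_nonneg ((z i - (1 - δ) * x i) / δ)
    have a2 := smoothStep_le_one ((z i - (1 - δ) * x i) / δ)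
    have a3 := smoothStep_nonneg ((z i - (1 - δ') * x i) / δ')
    have a4 := smoothStep_le_one ((z i - (1 - δ') * x i) / δ')
    unfold scaledStep
    constructor <;> linarith
  have h2 : ∏ j ∈ Finset.univ.erase i, |mixFactor δ δ' x i j (z j)| ≤ (C / δ') ^ (d - 1) := by
    have : (Finset.univ.erase i).card = d - 1 := by simp
    rw [← this, ← Finset.prod_const]
    refine Finset.prod_le_prod (fun _ _ => abs_nonneg _) fun j hj => ?_
    have hj' : j ≠ i := Finset.ne_of_mem_erase hj
    unfold mixFactor
    rw [if_neg hj']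
    split_ifs
    · exact abs_scaledBump_le hC hδ' _ _
    · exact (abs_scaledBump_le hC (hδ'.trans_le h) _ _).trans hle
  calc _ ≤ 1 * (C / δ') ^ (d - 1) :=
        mul_le_mul h1 h2 (Finset.prod_nonneg fun _ _ => abs_nonneg _) zero_le_one
    _ = _ := one_mul _

lemma abs_avgKernel_le {C : ℝ} (hC : ∀ u, deriv smoothStep u ≤ C) {δ : ℝ} (hδ : 0 < δ)
    (x z : Fin d → ℝ) : |avgKernel δ x z| ≤ (C / δ) ^ d := by
  unfold avgKernel
  rw [Finset.abs_prod]
  calc _ ≤ ∏ _i : Fin d, C / δ :=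
        Finset.prod_le_prod (fun _ _ => abs_nonneg _) fun j _ => abs_scaledBump_le hC hδ _ _
    _ = _ := by simp [div_pow]

lemma mem_closedBall_of_coord {x z : Fin d → ℝ} {δ : ℝ} (hδ : 0 ≤ δ)
    (h : ∀ i, z i ∈ Icc (x i - δ) (x i + δ)) : z ∈ Metric.closedBall x δ := by
  rw [Metric.mem_closedBall, dist_pi_le_iff hδ]
  intro i
  rw [Real.dist_eq, abs_le]
  constructor <;> linarith [(h i).1, (h i).2]

lemma avgKernel_eq_zero {δ : ℝ} (hδ : 0 < δ) {x z : Fin d → ℝ} (hx : x ∈ cube d)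
    (hz : z ∉ Metric.closedBall x δ) : avgKernel δ x z = 0 := by
  have : ∃ i, z i ∉ Icc (x i - δ) (x i + δ) := by
    by_contra hcon
    push Not at hcon
    exact hz (mem_closedBall_of_coord hδ.le hcon)
  obtain ⟨i, hi⟩ := this
  have hb := bump_interval' hδ (mem_cube_iff.1 hx i)
  exact Finset.prod_eq_zero (Finset.mem_univ i) (scaledBump_eq_zero hδ hb.1 hb.2 hi)

lemma continuous_avgKernel (δ : ℝ) (x : Fin d → ℝ) : Continuous (avgKernel δ x) :=
  continuous_finsetProd _ fun i _ =>
    (contDiff_scaledBump δ (x i)).continuous.comp (continuous_apply i)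

lemma prod_mixFactor_eq_zero {δ δ' : ℝ} (hδ' : 0 < δ') (h : δ' ≤ δ) {x z : Fin d → ℝ}
    (hx : x ∈ cube d) (i : Fin d) (hz : z ∉ Metric.closedBall x δ) :
    ∏ l, mixFactor δ δ' x i l (z l) = 0 := by
  have : ∃ i, z i ∉ Icc (x i - δ) (x i + δ) := by
    by_contra hcon
    push Not at hcon
    exact hz (mem_closedBall_of_coord (hδ'.trans_le h).le hcon)
  obtain ⟨l, hl⟩ := this
  have hb := bump_interval' (hδ'.trans_le h) (mem_cube_iff.1 hx l)
  have hb' := bump_interval' hδ' (mem_cube_iff.1 hx l)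
  exact Finset.prod_eq_zero (Finset.mem_univ l) (mixFactor_eq_zero (hδ'.trans_le h) hδ' hb.1 hb.2
    (by linarith [hb'.1]) (by linarith [hb'.2]) hl)

instance : IsFiniteMeasure (cubeMeasure d) :=
  ⟨by rw [cubeMeasure, Measure.restrict_apply_univ]; exact isCompact_Icc.measure_lt_top⟩

lemma enorm_localAvg_le {C : ℝ} (hC : ∀ u, deriv smoothStep u ≤ C) {δ : ℝ} (hδ : 0 < δ)
    {x : Fin d → ℝ} (hx : x ∈ cube d) (f : (Fin d → ℝ) → ℝ) :
    ‖localAvg δ f x‖ₑ ≤ ENNReal.ofReal ((C / δ) ^ d) *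
      ∫⁻ z in Metric.closedBall x δ, ‖f z‖ₑ ∂(cubeMeasure d) := by
  refine (enorm_integral_le_lintegral_enorm _).trans ?_
  rw [← lintegral_const_mul' _ _ ENNReal.ofReal_ne_top,
    ← lintegral_indicator Metric.isClosed_closedBall.measurableSet]
  refine lintegral_mono fun z => ?_
  by_cases hz : z ∈ Metric.closedBall x δ
  · rw [indicator_of_mem hz, enorm_mul, mul_comm]
    gcongr
    rw [← ofReal_norm]
    exact ENNReal.ofReal_le_ofReal (abs_avgKernel_le hC hδ x z)
  · rw [indicator_of_notMem hz, avgKernel_eq_zero hδ hx hz]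
    simp

lemma enorm_localAvg_sub_le {C : ℝ} (hC : ∀ u, deriv smoothStep u ≤ C) {δ : ℝ} (hδ : 0 < δ)
    (hδ1 : δ ≤ 1) {x : Fin d → ℝ} (hx : x ∈ cube d) {f : (Fin d → ℝ) → ℝ}
    {g : Fin d → (Fin d → ℝ) → ℝ} (hf : Integrable f (cubeMeasure d))
    (hfg : ∀ i, IsWeakPartial i f (g i)) :
    ‖localAvg δ f x - localAvg (δ / 2) f x‖ₑ ≤ ENNReal.ofReal ((2 * C / δ) ^ (d - 1)) *
      ∑ i, ∫⁻ z in Metric.closedBall x δ, ‖g i z‖ₑ ∂(cubeMeasure d) := by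
  have hδ2 : 0 < δ / 2 := by positivity
  have hle : δ / 2 ≤ δ := by linarith
  set Φ : Fin d → (Fin d → ℝ) → ℝ := fun i z => ∏ l, mixFactor δ (δ / 2) x i l (z l) with hΦ
  have hΦs : ∀ i, ContDiff ℝ ((⊤ : ℕ∞) : WithTop ℕ∞) (Φ i) := fun i =>
    contDiff_prod_coord (contDiff_mixFactor δ (δ / 2) x i)
  have hzero : ∀ i l z, z ∉ Icc (δ / 2 / 4) (1 - δ / 2 / 4) → mixFactor δ (δ / 2) x i l z = 0 := by
    intro i l z hz
    have hb := bump_interval hδ1 (mem_cube_iff.1 hx l)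
    have hb' := bump_interval (by linarith : δ / 2 ≤ 1) (mem_cube_iff.1 hx l)
    exact mixFactor_eq_zero hδ hδ2 (by linarith [hb.1]) (by linarith [hb.2]) hb'.1 hb'.2 hz
  have hΦc : ∀ i, HasCompactSupport (Φ i) := fun i => hasCompactSupport_prod_coord (hzero i)
  have hΦt : ∀ i, tsupport (Φ i) ⊆ interior (cube d) := fun i =>
    tsupport_prod_coord_subset (by positivity) (by linarith) (hzero i)
  have hint : ∀ δ : ℝ, 0 < δ → Integrable (fun z => f z * avgKernel δ x z) (cubeMeasure d) := by
    intro δ hδ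
    exact hf.mul_bdd (c := (C / δ) ^ d) (continuous_avgKernel δ x).aestronglyMeasurable
      (ae_of_all _ fun z => abs_avgKernel_le hC hδ x z)
  have hintp : ∀ i, Integrable (fun z => f z * partialDeriv i (Φ i) z) (cubeMeasure d) := by
    intro i
    have hcont := (contDiff_partialDeriv (hΦs i) i).continuous
    obtain ⟨M, hM⟩ := hcont.bounded_above_of_compact_support
      ((hΦc i).fderiv_apply (𝕜 := ℝ) _)
    exact hf.mul_bdd hcont.aestronglyMeasurable (ae_of_all _ hM)
  -- The derivative is moved from the test functions to `f`; this is where the weak gradient enters.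
  have heq : localAvg δ f x - localAvg (δ / 2) f x =
      ∑ i, -∫ z, g i z * Φ i z ∂(cubeMeasure d) := by
    unfold localAvg
    rw [← integral_sub (hint δ hδ) (hint _ hδ2)]
    simp_rw [← mul_sub, avgKernel_sub, Finset.mul_sum]
    rw [integral_finsetSum _ fun i _ => hintp i]
    exact Finset.sum_congr rfl fun i _ => hfg i _ (hΦs i) (hΦc i) (hΦt i)
  rw [heq, Finset.mul_sum]
  refine (enorm_sum_le _ _).trans (Finset.sum_le_sum fun i _ => ?_)
  rw [enorm_neg]
  refine (enorm_integral_le_lintegral_enorm _).trans ?_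
  rw [← lintegral_const_mul' _ _ ENNReal.ofReal_ne_top,
    ← lintegral_indicator Metric.isClosed_closedBall.measurableSet]
  refine lintegral_mono fun z => ?_
  by_cases hz : z ∈ Metric.closedBall x δ
  · rw [indicator_of_mem hz, enorm_mul, mul_comm]
    gcongr
    rw [← ofReal_norm]
    refine ENNReal.ofReal_le_ofReal ((abs_prod_mixFactor_le hC hδ2 hle x i z).trans ?_)
    rw [show C / (δ / 2) = 2 * C / δ by field_simp]
  · rw [indicator_of_notMem hz]
    simp only [hΦ, prod_mixFactor_eq_zero hδ2 hle hx i hz, mul_zero, enorm_zero, le_refl]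

lemma integral_avgKernel {δ : ℝ} (hδ : 0 < δ) (x : Fin d → ℝ) : ∫ z, avgKernel δ x z = 1 := by
  unfold avgKernel
  rw [integral_fintype_prod_volume_eq_prod (f := fun i z => scaledBump δ (x i) z)]
  simp [integral_scaledBump hδ]

lemma measureReal_closedBall (x : Fin d → ℝ) {δ : ℝ} (hδ : 0 ≤ δ) :
    (volume : Measure (Fin d → ℝ)).real (Metric.closedBall x δ) = (2 * δ) ^ d := by
  rw [measureReal_def, Real.volume_pi_closedBall x hδ]
  simp [ENNReal.toReal_ofReal (by positivity : (0 : ℝ) ≤ (2 * δ) ^ d)]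

/-- Lebesgue differentiation: the kernels have mass one, live on balls of radius `δ`, and are
bounded by a fixed multiple of the inverse volume of these balls. -/
lemma ae_tendsto_localAvg {f : (Fin d → ℝ) → ℝ} (hf : Integrable f (cubeMeasure d)) :
    ∀ᵐ x ∂(cubeMeasure d), Tendsto (fun j : ℕ => localAvg ((1 / 2) ^ j) f x) atTop (𝓝 (f x)) := by
  obtain ⟨C, hC1, hC⟩ := exists_deriv_smoothStep_le
  have hmeas : MeasurableSet (cube d) := measurableSet_Icc
  set F := (cube d).indicator f with hF
  have hFi : Integrable F := (integrable_indicator_iff hmeas).2 hf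
  have hδ : Tendsto (fun j : ℕ => ((1 / 2 : ℝ)) ^ j) atTop (𝓝[>] 0) :=
    tendsto_nhdsWithin_iff.2 ⟨tendsto_pow_atTop_nhds_zero_of_lt_one (by norm_num) (by norm_num),
      Eventually.of_forall fun j => by simp⟩
  have hleb := ae_restrict_of_ae (s := cube d)
    (IsUnifLocDoublingMeasure.ae_tendsto_average_norm_sub (μ := (volume : Measure (Fin d → ℝ)))
      hFi.locallyIntegrable 1)
  filter_upwards [hleb, ae_restrict_mem hmeas] with x hx hxc
  have h1 := hx (fun _ : ℕ => x) (fun j : ℕ => ((1 / 2 : ℝ)) ^ j) hδ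
    (Eventually.of_forall fun j => Metric.mem_closedBall_self (by positivity))
  have h2 := tendsto_integral_smul_of_tendsto_average_norm_sub
    (g := fun (j : ℕ) z => avgKernel ((1 / 2 : ℝ) ^ j) x z) ((2 * C) ^ d) h1
    (Eventually.of_forall fun j => hFi.integrableOn)
    (by
      refine tendsto_const_nhds.congr fun j => ?_
      exact (integral_avgKernel (by positivity) x).symm)
    (Eventually.of_forall fun j z hz => by
      by_contra hcon
      exact hz (avgKernel_eq_zero (by positivity) hxc hcon))
    (Eventually.of_forall fun j z => by
      rw [measureReal_closedBall x (by positivity)]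
      refine (abs_avgKernel_le hC (by positivity) x z).trans (le_of_eq ?_)
      rw [← div_pow]
      congr 1
      field_simp)
  have hFx : F x = f x := indicator_of_mem hxc f
  rw [hFx] at h2
  refine h2.congr fun j => ?_
  unfold localAvg cubeMeasure
  rw [← integral_indicator hmeas]
  refine integral_congr_ae (ae_of_all _ fun z => ?_)
  simp only [hF, smul_eq_mul, indicator]
  split_ifs <;> ring

end LocalAverages

/-! ### Integrability gained by integrating over small balls. -/

section BallAverages

variable {d : ℕ}

lemma cubeMeasure_closedBall_le (x : Fin d → ℝ) {δ : ℝ} (hδ : 0 ≤ δ) :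
    cubeMeasure d (Metric.closedBall x δ) ≤ ENNReal.ofReal ((2 * δ) ^ d) := by
  refine (Measure.restrict_apply_le _ _).trans ?_
  rw [Real.volume_pi_closedBall x hδ]
  simp

lemma lintegral_closedBall_le {G : (Fin d → ℝ) → ENNReal} (hG : AEMeasurable G (cubeMeasure d))
    {p δ : ℝ} (hp : 1 ≤ p) (hδ : 0 ≤ δ) (x : Fin d → ℝ) :
    ∫⁻ z in Metric.closedBall x δ, G z ∂(cubeMeasure d) ≤
      (∫⁻ z in Metric.closedBall x δ, G z ^ p ∂(cubeMeasure d)) ^ (1 / p) *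
        ENNReal.ofReal ((2 * δ) ^ d) ^ (1 - 1 / p) := by
  have hp0 : 0 < p := by linarith
  have h1p : 0 ≤ 1 - 1 / p := by
    rw [sub_nonneg, div_le_one hp0]; exact hp
  have := ENNReal.lintegral_mul_norm_pow_le (μ := (cubeMeasure d).restrict (Metric.closedBall x δ))
    (f := fun z => G z ^ p) (g := fun _ => 1) (hG.restrict.pow_const p) aemeasurable_const
    (p := 1 / p) (q := 1 - 1 / p) (by positivity) h1p (by ring)
  simp only [ENNReal.one_rpow, mul_one, lintegral_one, Measure.restrict_apply_univ] at this
  calc _ = ∫⁻ z in Metric.closedBall x δ, (G z ^ p) ^ (1 / p) ∂(cubeMeasure d) := by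
        refine lintegral_congr fun z => ?_
        rw [← ENNReal.rpow_mul, mul_one_div_cancel hp0.ne', ENNReal.rpow_one]
    _ ≤ _ := this
    _ ≤ _ := by
        gcongr
        exact cubeMeasure_closedBall_le x hδ

/-- Tonelli and the symmetry of `dist x z ≤ δ`: each point `z` is counted with the measure of its
own ball. -/
lemma lintegral_lintegral_closedBall_le {G : (Fin d → ℝ) → ENNReal}
    (hG : AEMeasurable G (cubeMeasure d)) {δ : ℝ} (hδ : 0 ≤ δ) :
    ∫⁻ x, ∫⁻ z in Metric.closedBall x δ, G z ∂(cubeMeasure d) ∂(cubeMeasure d) ≤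
      ENNReal.ofReal ((2 * δ) ^ d) * ∫⁻ z, G z ∂(cubeMeasure d) := by
  have hS : MeasurableSet {t : (Fin d → ℝ) × (Fin d → ℝ) | dist t.2 t.1 ≤ δ} :=
    (isClosed_le (by fun_prop) continuous_const).measurableSet
  have hmeas : AEMeasurable (Function.uncurry fun x z : Fin d → ℝ =>
      {t : (Fin d → ℝ) × (Fin d → ℝ) | dist t.2 t.1 ≤ δ}.indicator (fun t => G t.2) (x, z))
      ((cubeMeasure d).prod (cubeMeasure d)) :=
    (AEMeasurable.comp_snd hG).indicator hS
  have h1 : ∀ x, ∫⁻ z in Metric.closedBall x δ, G z ∂(cubeMeasure d) =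
      ∫⁻ z, {t : (Fin d → ℝ) × (Fin d → ℝ) | dist t.2 t.1 ≤ δ}.indicator (fun t => G t.2) (x, z)
        ∂(cubeMeasure d) := by
    intro x
    rw [← lintegral_indicator Metric.isClosed_closedBall.measurableSet]
    rfl
  simp_rw [h1]
  rw [lintegral_lintegral_swap hmeas, ← lintegral_const_mul' _ _ ENNReal.ofReal_ne_top]
  refine lintegral_mono fun z => ?_
  have h2 : ∀ x, {t : (Fin d → ℝ) × (Fin d → ℝ) | dist t.2 t.1 ≤ δ}.indicator
      (fun t => G t.2) (x, z) = (Metric.closedBall z δ).indicator (fun _ => G z) x := by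
    intro x
    simp only [indicator, mem_ofPred_eq, Metric.mem_closedBall, dist_comm x z]
  simp_rw [h2]
  rw [lintegral_indicator_const Metric.isClosed_closedBall.measurableSet, mul_comm]
  gcongr
  exact cubeMeasure_closedBall_le z hδ

/-- Integrals over balls of radius `δ` gain integrability from `L^p` to `L^v`. -/
lemma lintegral_rpow_lintegral_closedBall_le {G : (Fin d → ℝ) → ENNReal}
    (hG : AEMeasurable G (cubeMeasure d)) {p v δ : ℝ} (hp : 1 ≤ p) (hpv : p ≤ v) (hδ : 0 ≤ δ)
    (hNt : ∫⁻ z, G z ^ p ∂(cubeMeasure d) ≠ ⊤) :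
    ∫⁻ x, (∫⁻ z in Metric.closedBall x δ, G z ∂(cubeMeasure d)) ^ v ∂(cubeMeasure d) ≤
      (ENNReal.ofReal ((2 * δ) ^ d) ^ (1 - 1 / p + 1 / v) *
        (∫⁻ z, G z ^ p ∂(cubeMeasure d)) ^ (1 / p)) ^ v := by
  have hp0 : 0 < p := by linarith
  have hv0 : 0 < v := by linarith
  have h1p : 0 ≤ 1 - 1 / p := by
    rw [sub_nonneg, div_le_one hp0]; exact hp
  have hvp : 0 ≤ v / p - 1 := by
    rw [sub_nonneg, one_le_div hp0]; exact hpv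
  set V := ENNReal.ofReal ((2 * δ) ^ d)
  set N := ∫⁻ z, G z ^ p ∂(cubeMeasure d) with hN
  -- After Hölder on the ball, one power of the local integral of `G ^ p` is kept for Tonelli, and
  -- the other `v / p - 1` powers are bounded by the global integral.
  have hpt : ∀ x, (∫⁻ z in Metric.closedBall x δ, G z ∂(cubeMeasure d)) ^ v ≤
      (V ^ ((1 - 1 / p) * v) * N ^ (v / p - 1)) *
        ∫⁻ z in Metric.closedBall x δ, G z ^ p ∂(cubeMeasure d) := by
    intro x
    set I := ∫⁻ z in Metric.closedBall x δ, G z ^ p ∂(cubeMeasure d)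
    have hIN : I ≤ N := setLIntegral_le_lintegral _ _
    calc _ ≤ (I ^ (1 / p) * V ^ (1 - 1 / p)) ^ v := by
          gcongr
          exact lintegral_closedBall_le hG hp hδ x
      _ = I ^ (v / p - 1) * I * V ^ ((1 - 1 / p) * v) := by
          rw [ENNReal.mul_rpow_of_nonneg _ _ hv0.le, ← ENNReal.rpow_mul, ← ENNReal.rpow_mul]
          congr 1
          conv_rhs => rw [← ENNReal.rpow_one I, ← ENNReal.rpow_mul, one_mul,
            ← ENNReal.rpow_add_of_nonneg _ _ hvp zero_le_one]
          congr 1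
          ring
      _ ≤ N ^ (v / p - 1) * I * V ^ ((1 - 1 / p) * v) := by gcongr
      _ = _ := by ring
  calc _ ≤ ∫⁻ x, (V ^ ((1 - 1 / p) * v) * N ^ (v / p - 1)) *
        ∫⁻ z in Metric.closedBall x δ, G z ^ p ∂(cubeMeasure d) ∂(cubeMeasure d) :=
        lintegral_mono hpt
    _ ≤ (V ^ ((1 - 1 / p) * v) * N ^ (v / p - 1)) *
        ∫⁻ x, ∫⁻ z in Metric.closedBall x δ, G z ^ p ∂(cubeMeasure d) ∂(cubeMeasure d) := by
        rw [lintegral_const_mul']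
        exact ENNReal.mul_ne_top (ENNReal.rpow_ne_top_of_nonneg (by positivity) (by simp [V]))
          (ENNReal.rpow_ne_top_of_nonneg hvp hNt)
    _ ≤ (V ^ ((1 - 1 / p) * v) * N ^ (v / p - 1)) * (V * N) := by
        gcongr
        exact lintegral_lintegral_closedBall_le (hG.pow_const p) hδ
    _ = _ := by
        rw [ENNReal.mul_rpow_of_nonneg _ _ hv0.le, ← ENNReal.rpow_mul, ← ENNReal.rpow_mul]
        have e1 : (1 - 1 / p + 1 / v) * v = (1 - 1 / p) * v + 1 := by field_simp
        have e2 : 1 / p * v = (v / p - 1) + 1 := by ring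
        rw [e1, e2, ENNReal.rpow_add_of_nonneg _ _ (by positivity) zero_le_one,
          ENNReal.rpow_add_of_nonneg _ _ hvp zero_le_one, ENNReal.rpow_one, ENNReal.rpow_one]
        ring

lemma eLpNorm_ofReal_eq {α ε : Type*} [MeasurableSpace α] [ENorm ε] {μ : Measure α} {p : ℝ}
    (hp : 0 < p) (f : α → ε) :
    eLpNorm f (ENNReal.ofReal p) μ = (∫⁻ x, ‖f x‖ₑ ^ p ∂μ) ^ (1 / p) := by
  rw [eLpNorm_eq_lintegral_rpow_enorm_toReal (by simpa using hp) ENNReal.ofReal_ne_top,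
    ENNReal.toReal_ofReal hp.le]

lemma eLpNorm_le_of_le_lintegral_closedBall {F : (Fin d → ℝ) → ℝ} {G : (Fin d → ℝ) → ENNReal}
    (hG : AEMeasurable G (cubeMeasure d)) {p v δ : ℝ} (hp : 1 ≤ p) (hpv : p ≤ v) (hδ : 0 ≤ δ)
    (hNt : eLpNorm G (ENNReal.ofReal p) (cubeMeasure d) ≠ ⊤) {K : ENNReal} (hK : K ≠ ⊤)
    (hF : ∀ᵐ x ∂(cubeMeasure d), ‖F x‖ₑ ≤
      K * ∫⁻ z in Metric.closedBall x δ, G z ∂(cubeMeasure d)) :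
    eLpNorm F (ENNReal.ofReal v) (cubeMeasure d) ≤
      K * ENNReal.ofReal ((2 * δ) ^ d) ^ (1 - 1 / p + 1 / v) *
        eLpNorm G (ENNReal.ofReal p) (cubeMeasure d) := by
  have hp0 : 0 < p := by linarith
  have hv0 : 0 < v := by linarith
  rw [eLpNorm_ofReal_eq hp0] at hNt ⊢
  simp only [enorm_eq_self] at hNt ⊢
  have hNt' : ∫⁻ z, G z ^ p ∂(cubeMeasure d) ≠ ⊤ := by
    intro h
    rw [h, ENNReal.top_rpow_of_pos (by positivity)] at hNt
    exact hNt rfl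
  rw [eLpNorm_ofReal_eq hv0, one_div, ENNReal.rpow_inv_le_iff hv0]
  calc ∫⁻ x, ‖F x‖ₑ ^ v ∂(cubeMeasure d)
      ≤ ∫⁻ x, K ^ v * (∫⁻ z in Metric.closedBall x δ, G z ∂(cubeMeasure d)) ^ v
          ∂(cubeMeasure d) := by
        refine lintegral_mono_ae ?_
        filter_upwards [hF] with x hx
        rw [← ENNReal.mul_rpow_of_nonneg _ _ hv0.le]
        gcongr
    _ ≤ K ^ v * (ENNReal.ofReal ((2 * δ) ^ d) ^ (1 - 1 / p + 1 / v) *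
        (∫⁻ z, G z ^ p ∂(cubeMeasure d)) ^ (1 / p)) ^ v := by
        rw [lintegral_const_mul' _ _ (ENNReal.rpow_ne_top_of_nonneg hv0.le hK)]
        gcongr
        exact lintegral_rpow_lintegral_closedBall_le hG hp hpv hδ hNt'
    _ = _ := by rw [← ENNReal.mul_rpow_of_nonneg _ _ hv0.le, mul_assoc]; simp only [one_div]

end BallAverages

/-! ### The first-order Sobolev inequality. -/

section FirstOrder

variable {d : ℕ}

lemma aestronglyMeasurable_localAvg {f : (Fin d → ℝ) → ℝ}
    (hf : AEStronglyMeasurable f (cubeMeasure d)) (δ : ℝ) :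
    AEStronglyMeasurable (localAvg δ f) (cubeMeasure d) := by
  have hk : Continuous fun t : (Fin d → ℝ) × (Fin d → ℝ) => avgKernel δ t.1 t.2 := by
    unfold avgKernel scaledBump
    refine continuous_finsetProd _ fun i _ => continuous_const.mul
      (contDiff_deriv_smoothStep.continuous.comp ?_)
    fun_prop
  exact AEStronglyMeasurable.integral_prod_right'
    (f := fun t : (Fin d → ℝ) × (Fin d → ℝ) => f t.2 * avgKernel δ t.1 t.2)
    (hf.comp_snd.mul hk.aestronglyMeasurable)

/-- By Bernoulli, `(1 / 2) ^ e ≤ 1 - e / 2`, so the geometric series is at most `2 / e`. -/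
lemma sum_geometric_rpow_le {e : ℝ} (he : 0 < e) (he1 : e ≤ 1) (n : ℕ) :
    ∑ j ∈ Finset.range n, ((1 / 2 : ℝ) ^ e) ^ j ≤ 2 / e := by
  have h0 : 0 ≤ (1 / 2 : ℝ) ^ e := by positivity
  have h1 : (1 / 2 : ℝ) ^ e ≤ 1 - e / 2 := by
    have := rpow_one_add_le_one_add_mul_self (s := -(1 / 2)) (by norm_num) he.le he1
    norm_num at this ⊢
    linarith
  have hS : 0 ≤ ∑ j ∈ Finset.range n, ((1 / 2 : ℝ) ^ e) ^ j :=
    Finset.sum_nonneg fun j _ => by positivity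
  have h2 := geom_sum_mul_neg ((1 / 2 : ℝ) ^ e) n
  have h3 : 0 ≤ ((1 / 2 : ℝ) ^ e) ^ n := by positivity
  rw [le_div_iff₀ he]
  nlinarith

/-- The first-order Sobolev inequality on the cube below the critical exponent, with the
dependence of the constant on the distance to the critical exponent. -/
theorem exists_eLpNorm_le_of_weakPartial (hd : 0 < d) : ∃ C : ℝ, 1 ≤ C ∧
    ∀ (p v e : ℝ), 1 ≤ p → p ≤ v → 0 < e → e ≤ 1 → e ≤ 1 - d * (1 / p - 1 / v) →
    ∀ (f : (Fin d → ℝ) → ℝ) (g : Fin d → (Fin d → ℝ) → ℝ) (R : ℝ), 0 ≤ R →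
      MemLp f (ENNReal.ofReal p) (cubeMeasure d) →
      (∀ i, MemLp (g i) (ENNReal.ofReal p) (cubeMeasure d)) →
      (∀ i, IsWeakPartial i f (g i)) →
      eLpNorm f (ENNReal.ofReal p) (cubeMeasure d) ≤ ENNReal.ofReal R →
      (∀ i, eLpNorm (g i) (ENNReal.ofReal p) (cubeMeasure d) ≤ ENNReal.ofReal R) →
      eLpNorm f (ENNReal.ofReal v) (cubeMeasure d) ≤ ENNReal.ofReal (C / e * R) := by
  obtain ⟨c, hc1, hc⟩ := exists_deriv_smoothStep_le
  have hc0 : 0 < c := by linarith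
  have hcube : MeasurableSet (cube d) := measurableSet_Icc
  refine ⟨c ^ d * 4 ^ d + (2 * c) ^ (d - 1) * 4 ^ d * d * 2, ?_, ?_⟩
  · have : (1 : ℝ) ≤ c ^ d * 4 ^ d := by
      rw [← mul_pow]; exact one_le_pow₀ (by linarith)
    have : 0 ≤ (2 * c) ^ (d - 1) * 4 ^ d * d * 2 := by positivity
    linarith
  intro p v e hp hpv he he1 hepv f g R hR hf hg hfg hfR hgR
  have hp0 : 0 < p := by linarith
  have hv0 : 0 < v := by linarith
  have h1v : 1 ≤ v := hp.trans hpv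
  have hexp0 : 0 ≤ 1 - 1 / p + 1 / v := by
    have : 1 / p ≤ 1 := by rw [div_le_one hp0]; exact hp
    have : 0 < 1 / v := by positivity
    linarith
  have hexp2 : 1 - 1 / p + 1 / v ≤ 2 := by
    have : 1 / v ≤ 1 := by rw [div_le_one hv0]; exact h1v
    have : 0 < 1 / p := by positivity
    linarith
  have hpE : 1 ≤ ENNReal.ofReal p := by simpa using ENNReal.ofReal_le_ofReal hp
  have hvE : 1 ≤ ENNReal.ofReal v := by simpa using ENNReal.ofReal_le_ofReal h1v
  have hfi : Integrable f (cubeMeasure d) := hf.integrable hpE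
  set G : (Fin d → ℝ) → ENNReal := ∑ i, fun z => ‖g i z‖ₑ with hG
  have hGm : AEMeasurable G (cubeMeasure d) :=
    Finset.aemeasurable_sum _ fun i _ => (hg i).1.enorm
  have hGR : eLpNorm G (ENNReal.ofReal p) (cubeMeasure d) ≤ ENNReal.ofReal (d * R) := by
    refine (eLpNorm_sum_le (fun i _ => (hg i).1.enorm.aestronglyMeasurable) hpE).trans ?_
    simp_rw [eLpNorm_enorm]
    refine (Finset.sum_le_sum fun i _ => hgR i).trans ?_
    rw [Finset.sum_const, Finset.card_univ, Fintype.card_fin, nsmul_eq_mul,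
      ENNReal.ofReal_mul (by positivity), ENNReal.ofReal_natCast]
  set θ := 1 - 1 / p + 1 / v with hθ
  have hbase : eLpNorm (localAvg ((1 / 2) ^ 0) f) (ENNReal.ofReal v) (cubeMeasure d) ≤
      ENNReal.ofReal (c ^ d * 4 ^ d * R) := by
    have h := eLpNorm_le_of_le_lintegral_closedBall (F := localAvg ((1 / 2) ^ 0) f)
      (G := fun z => ‖f z‖ₑ) hf.1.enorm hp hpv zero_le_one
      (by rw [eLpNorm_enorm]; exact hf.2.ne) (K := ENNReal.ofReal (c ^ d)) ENNReal.ofReal_ne_top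
      (by
        filter_upwards [ae_restrict_mem hcube] with x hx
        have := enorm_localAvg_le hc zero_lt_one hx f
        simpa using this)
    rw [eLpNorm_enorm] at h
    refine h.trans ?_
    rw [ENNReal.ofReal_rpow_of_nonneg (by positivity) hexp0, ENNReal.ofReal_mul (by positivity),
      ENNReal.ofReal_mul (by positivity)]
    gcongr
    rw [mul_one]
    calc ((2 : ℝ) ^ d) ^ θ ≤ ((2 : ℝ) ^ d) ^ (2 : ℝ) :=
          Real.rpow_le_rpow_of_exponent_le (one_le_pow₀ (by norm_num)) hexp2
      _ = 4 ^ d := by rw [Real.rpow_two, ← pow_mul, mul_comm, pow_mul]; norm_num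
  have hdiff : ∀ j : ℕ, eLpNorm (localAvg ((1 / 2) ^ j) f - localAvg ((1 / 2) ^ (j + 1)) f)
      (ENNReal.ofReal v) (cubeMeasure d) ≤
      ENNReal.ofReal ((2 * c) ^ (d - 1) * 4 ^ d * (d * R) * ((1 / 2 : ℝ) ^ e) ^ j) := by
    intro j
    set δ : ℝ := (1 / 2) ^ j with hδ
    have hδ0 : 0 < δ := by positivity
    have hδ1 : δ ≤ 1 := pow_le_one₀ (by norm_num) (by norm_num)
    have hpow : (1 / 2 : ℝ) ^ (j + 1) = δ / 2 := by rw [pow_succ]; ring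
    rw [hpow]
    have h := eLpNorm_le_of_le_lintegral_closedBall (F := localAvg δ f - localAvg (δ / 2) f)
      hGm hp hpv hδ0.le (ne_top_of_le_ne_top ENNReal.ofReal_ne_top hGR)
      (K := ENNReal.ofReal ((2 * c / δ) ^ (d - 1))) ENNReal.ofReal_ne_top
      (by
        filter_upwards [ae_restrict_mem hcube] with x hx
        refine (enorm_localAvg_sub_le hc hδ0 hδ1 hx hfi hfg).trans (le_of_eq ?_)
        rw [hG, ← lintegral_finsetSum' _ fun i _ => (hg i).1.enorm.restrict]
        simp)
    refine h.trans ?_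
    rw [ENNReal.ofReal_rpow_of_nonneg (by positivity) hexp0]
    calc _ ≤ ENNReal.ofReal ((2 * c / δ) ^ (d - 1)) * ENNReal.ofReal (((2 * δ) ^ d) ^ θ) *
          ENNReal.ofReal (d * R) := by gcongr
      _ = ENNReal.ofReal ((2 * c / δ) ^ (d - 1) * ((2 * δ) ^ d) ^ θ * (d * R)) := by
        rw [ENNReal.ofReal_mul (p := (2 * c / δ) ^ (d - 1) * ((2 * δ) ^ d) ^ θ) (by positivity),
          ENNReal.ofReal_mul (p := (2 * c / δ) ^ (d - 1)) (by positivity)]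
      _ ≤ _ := by
        apply ENNReal.ofReal_le_ofReal
        have e1 : ((2 * δ) ^ d) ^ θ ≤ 4 ^ d * δ ^ (d * θ) := by
          rw [mul_pow, Real.mul_rpow (by positivity) (by positivity), ← Real.rpow_natCast δ d,
            ← Real.rpow_mul hδ0.le]
          gcongr
          calc ((2 : ℝ) ^ d) ^ θ ≤ ((2 : ℝ) ^ d) ^ (2 : ℝ) :=
                Real.rpow_le_rpow_of_exponent_le (one_le_pow₀ (by norm_num)) hexp2
            _ = 4 ^ d := by rw [Real.rpow_two, ← pow_mul, mul_comm, pow_mul]; norm_num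
        have e2 : (2 * c / δ) ^ (d - 1) = (2 * c) ^ (d - 1) * δ ^ (-((d : ℝ) - 1)) := by
          rw [div_pow, Real.rpow_neg hδ0.le, div_eq_mul_inv, ← Real.rpow_natCast δ (d - 1),
            Nat.cast_sub hd, Nat.cast_one]
        -- The kernels cost `δ ^ (-(d - 1))` and the ball integrals gain `δ ^ (d θ)`; the net
        -- exponent `1 - d (1 / p - 1 / v)` is at least `e`.
        have e3 : δ ^ (-((d : ℝ) - 1)) * δ ^ (d * θ) ≤ ((1 / 2 : ℝ) ^ e) ^ j := by
          rw [← Real.rpow_add hδ0, ← Real.rpow_natCast, ← Real.rpow_mul (by norm_num),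
            mul_comm e, Real.rpow_mul (by norm_num), Real.rpow_natCast]
          refine Real.rpow_le_rpow_of_exponent_ge hδ0 hδ1 ?_
          rw [hθ]
          linarith
        calc _ ≤ (2 * c) ^ (d - 1) * δ ^ (-((d : ℝ) - 1)) * (4 ^ d * δ ^ (d * θ)) * (d * R) := by
              rw [e2]; gcongr
          _ = (2 * c) ^ (d - 1) * 4 ^ d * (d * R) * (δ ^ (-((d : ℝ) - 1)) * δ ^ (d * θ)) := by ring
          _ ≤ _ := by gcongr
  have hmeas : ∀ j : ℕ, AEStronglyMeasurable (localAvg ((1 / 2) ^ j) f) (cubeMeasure d) :=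
    fun j => aestronglyMeasurable_localAvg hf.1 _
  have hbound : ∀ n : ℕ, eLpNorm (localAvg ((1 / 2) ^ n) f) (ENNReal.ofReal v) (cubeMeasure d) ≤
      ENNReal.ofReal ((c ^ d * 4 ^ d + (2 * c) ^ (d - 1) * 4 ^ d * d * 2) / e * R) := by
    intro n
    have htel : localAvg ((1 / 2) ^ n) f = localAvg ((1 / 2) ^ 0) f -
        ∑ j ∈ Finset.range n, (localAvg ((1 / 2) ^ j) f - localAvg ((1 / 2) ^ (j + 1)) f) := by
      rw [Finset.sum_range_sub']
      abel
    rw [htel]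
    refine (eLpNorm_sub_le (hmeas 0) (Finset.aestronglyMeasurable_sum _ fun j _ =>
      (hmeas j).sub (hmeas (j + 1))) hvE).trans ?_
    calc _ ≤ ENNReal.ofReal (c ^ d * 4 ^ d * R) + ∑ j ∈ Finset.range n,
          ENNReal.ofReal ((2 * c) ^ (d - 1) * 4 ^ d * (d * R) * ((1 / 2 : ℝ) ^ e) ^ j) := by
          gcongr
          exact (eLpNorm_sum_le (fun j _ => (hmeas j).sub (hmeas (j + 1))) hvE).trans
            (Finset.sum_le_sum fun j _ => hdiff j)
      _ = ENNReal.ofReal (c ^ d * 4 ^ d * R + (2 * c) ^ (d - 1) * 4 ^ d * (d * R) *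
          ∑ j ∈ Finset.range n, ((1 / 2 : ℝ) ^ e) ^ j) := by
          have hS : 0 ≤ ∑ j ∈ Finset.range n, ((1 / 2 : ℝ) ^ e) ^ j :=
            Finset.sum_nonneg fun j _ => by positivity
          rw [← ENNReal.ofReal_sum_of_nonneg (fun j _ => by positivity), ← Finset.mul_sum,
            ← ENNReal.ofReal_add (by positivity) (mul_nonneg (by positivity) hS)]
      _ ≤ _ := by
          apply ENNReal.ofReal_le_ofReal
          calc _ ≤ c ^ d * 4 ^ d * R * (1 / e) + (2 * c) ^ (d - 1) * 4 ^ d * (d * R) * (2 / e) := by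
                refine add_le_add ?_ ?_
                · refine le_mul_of_one_le_right (by positivity) ?_
                  rw [le_div_iff₀ he]; linarith
                · exact mul_le_mul_of_nonneg_left (sum_geometric_rpow_le he he1 n) (by positivity)
            _ = _ := by field_simp
  -- The bound is uniform in the scale, so Fatou passes it to the almost everywhere limit `f`.
  refine (Lp.eLpNorm_lim_le_liminf_eLpNorm hmeas f (ae_tendsto_localAvg hfi)).trans ?_
  exact liminf_le_of_le (by isBoundedDefault) fun b hb => by
    obtain ⟨n, hn⟩ := hb.exists
    exact hn.trans (hbound n)

end FirstOrder

/-! ### The Sobolev embedding of order `s`. -/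

section Embedding

variable {d : ℕ}

/-- `f` has weak derivatives up to order `s`, bounded by `R` in `L^p`. -/
def HasWeakDerivsLE (s : ℕ) (p R : ℝ) (f : (Fin d → ℝ) → ℝ) : Prop :=
  ∃ G : (Fin d → ℕ) → (Fin d → ℝ) → ℝ, G 0 = f ∧ ∀ α : Fin d → ℕ, ∑ i, α i ≤ s →
    MemLp (G α) (ENNReal.ofReal p) (cubeMeasure d) ∧ IsWeakDeriv α f (G α) ∧
      eLpNorm (G α) (ENNReal.ofReal p) (cubeMeasure d) ≤ ENNReal.ofReal R

lemma SobolevNormLE.hasWeakDerivsLE {s : ℕ} {p R : ℝ} {f : (Fin d → ℝ) → ℝ}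
    (h : SobolevNormLE s p R f) : HasWeakDerivsLE s p R f := by
  classical
  obtain ⟨⟨hf, hex⟩, hle⟩ := h
  -- Order zero is set apart so that the chosen family starts with `f` itself instead of another
  -- weak derivative of order zero.
  refine ⟨fun α => if α = 0 then f else
    if hα : ∑ i, α i ≤ s then (hex α hα).choose else 0, by simp, fun α hα => ?_⟩
  by_cases h0 : α = 0
  · subst h0
    simp only [if_true]
    exact ⟨hf, isWeakDeriv_zero f, hle 0 hα f hf (isWeakDeriv_zero f)⟩
  · simp only [h0, hα, if_false, dif_pos]
    have := (hex α hα).choose_spec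
    exact ⟨this.1, this.2, hle α hα _ this.1 this.2⟩

/-- The Sobolev embedding on the cube below the critical exponent, with the dependence of the
constant on the distance to the critical exponent. -/
theorem exists_eLpNorm_le_of_hasWeakDerivsLE (hd : 0 < d) : ∃ C : ℝ, 1 ≤ C ∧
    ∀ (s : ℕ) (p v ε R : ℝ), 1 ≤ p → p ≤ v → 0 < ε → ε ≤ 1 →
      1 / p - s * (1 - ε) / d ≤ 1 / v → 0 ≤ R →
    ∀ f : (Fin d → ℝ) → ℝ, HasWeakDerivsLE s p R f →
      eLpNorm f (ENNReal.ofReal v) (cubeMeasure d) ≤ ENNReal.ofReal ((C / ε) ^ s * R) := by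
  obtain ⟨C, hC1, hC⟩ := exists_eLpNorm_le_of_weakPartial hd
  refine ⟨C, hC1, fun s => ?_⟩
  have hd0 : (0 : ℝ) < d := by exact_mod_cast hd
  induction s with
  | zero =>
    intro p v ε R hp hpv hε hε1 hv hR f hf
    obtain ⟨G, hG0, hG⟩ := hf
    have hp0 : 0 < p := by linarith
    have : v = p := by
      refine le_antisymm ?_ hpv
      simp only [Nat.cast_zero, zero_mul, zero_div, sub_zero] at hv
      exact (one_div_le_one_div hp0 (by linarith)).1 hv
    subst this
    rw [pow_zero, one_mul, ← hG0]
    exact (hG 0 (by simp)).2.2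
  | succ s ih =>
    intro p v ε R hp hpv hε hε1 hv hR f hf
    obtain ⟨G, hG0, hG⟩ := hf
    have hp0 : 0 < p := by linarith
    have hv0 : 0 < v := by linarith
    have hε' : 0 ≤ (1 - ε) / d := div_nonneg (by linarith) hd0.le
    -- `1 / β` is the exponent reached with one derivative at relative loss `ε`, capped at the
    -- target `v`.
    set β := max (1 / p - (1 - ε) / d) (1 / v) with hβ
    have hβ0 : 0 < β := lt_max_of_lt_right (by positivity)
    have hβp : β ≤ 1 / p := max_le (by linarith) (one_div_le_one_div_of_le hp0 hpv)
    have hpp' : p ≤ 1 / β := by rwa [le_one_div hp0 hβ0]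
    have hp'v : 1 / β ≤ v := by
      rw [one_div_le hβ0 hv0]; exact le_max_right _ _
    have hstep : ε ≤ 1 - d * (1 / p - 1 / (1 / β)) := by
      rw [one_div_one_div]
      have h1 : 1 / p - β ≤ (1 - ε) / d := by linarith [le_max_left (1 / p - (1 - ε) / d) (1 / v)]
      rw [le_div_iff₀ hd0] at h1
      linarith
    have hCε : 0 ≤ C / ε := by positivity
    -- The first-order inequality is applied to every derivative of order at most `s`; the same
    -- family then serves at the larger exponent.
    have hnew : HasWeakDerivsLE s (1 / β) (C / ε * R) f := by
      refine ⟨G, hG0, fun α hα => ?_⟩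
      obtain ⟨hm, hw, hle⟩ := hG α (hα.trans (Nat.le_succ s))
      have hadd : ∀ i : Fin d, ∑ j, (α + Pi.single i 1 : Fin d → ℕ) j ≤ s + 1 := by
        intro i
        simp only [Pi.add_apply, Finset.sum_add_distrib, Finset.sum_pi_single', Finset.mem_univ,
          if_true]
        omega
      have key := hC p (1 / β) ε hp hpp' hε hε1 hstep (G α) (fun i => G (α + Pi.single i 1)) R hR hm
        (fun i => (hG _ (hadd i)).1) (fun i => hw.isWeakPartial (hG _ (hadd i)).2.1) hle
        (fun i => (hG _ (hadd i)).2.2)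
      exact ⟨⟨hm.1, key.trans_lt ENNReal.ofReal_lt_top⟩, hw, key⟩
    have hfin : 1 / (1 / β) - s * (1 - ε) / d ≤ 1 / v := by
      rw [one_div_one_div, sub_le_iff_le_add]
      have hs0 : 0 ≤ s * (1 - ε) / d := by
        have : 0 ≤ 1 - ε := by linarith
        positivity
      refine max_le ?_ (by linarith)
      push_cast at hv
      have : ((s : ℝ) + 1) * (1 - ε) / d = s * (1 - ε) / d + (1 - ε) / d := by ring
      linarith
    have := ih (1 / β) v ε (C / ε * R) (hp.trans hpp') hp'v hε hε1 hfin (by positivity) f hnew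
    rwa [← mul_assoc, ← pow_succ] at this

end Embedding

/-! ### Sample means and sample splitting. -/

section SampleMean

open ProbabilityTheory

lemma sampleMean_estimates {E : Type*} [MeasurableSpace E] {ν : Measure E} [IsProbabilityMeasure ν]
    {Y : E → ℝ} (hY : MemLp Y 2 ν) {m : ℕ} (hm : 1 ≤ m) :
    Integrable (fun x : Fin m → E => 1 / (m : ℝ) * ∑ i, Y (x i)) (Measure.pi fun _ => ν) ∧
    ∫ x : Fin m → E, 1 / (m : ℝ) * ∑ i, Y (x i) ∂(Measure.pi fun _ => ν) = ∫ z, Y z ∂ν ∧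
    ∫⁻ x : Fin m → E, ‖1 / (m : ℝ) * ∑ i, Y (x i) - ∫ z, Y z ∂ν‖ₑ ^ 2 ∂(Measure.pi fun _ => ν) ≤
      ENNReal.ofReal (1 / m) * ∫⁻ z, ‖Y z‖ₑ ^ 2 ∂ν := by
  have hm0 : (0 : ℝ) < m := by exact_mod_cast hm
  set P : Measure (Fin m → E) := Measure.pi fun _ => ν with hP
  have hmp : ∀ i : Fin m, MeasurePreserving (Function.eval i) P ν := fun i =>
    measurePreserving_eval (fun _ : Fin m => ν) i
  have hYi : ∀ i : Fin m, MemLp (fun x : Fin m → E => Y (x i)) 2 P := fun i =>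
    hY.comp_measurePreserving (hmp i)
  have hsum : MemLp (fun x : Fin m → E => ∑ i, Y (x i)) 2 P :=
    memLp_finsetSum _ fun i _ => hYi i
  have hX : MemLp (fun x : Fin m → E => 1 / (m : ℝ) * ∑ i, Y (x i)) 2 P := hsum.const_mul _
  have hmean : ∫ x : Fin m → E, 1 / (m : ℝ) * ∑ i, Y (x i) ∂P = ∫ z, Y z ∂ν := by
    rw [integral_const_mul, integral_finsetSum _ fun i _ => (hYi i).integrable one_le_two]
    have : ∀ i : Fin m, ∫ x : Fin m → E, Y (x i) ∂P = ∫ z, Y z ∂ν := by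
      intro i
      rw [← (hmp i).map_eq, integral_map (hmp i).aemeasurable]
      rw [(hmp i).map_eq]
      exact hY.1
    simp_rw [this]
    rw [Finset.sum_const, Finset.card_univ, Fintype.card_fin, nsmul_eq_mul]
    field_simp
  refine ⟨hX.integrable one_le_two, hmean, ?_⟩
  have hev : ∫⁻ x : Fin m → E, ‖1 / (m : ℝ) * ∑ i, Y (x i) - ∫ z, Y z ∂ν‖ₑ ^ 2 ∂P =
      evariance (fun x : Fin m → E => 1 / (m : ℝ) * ∑ i, Y (x i)) P := by
    rw [evariance, hmean]
  have hvar : variance (fun x : Fin m → E => 1 / (m : ℝ) * ∑ i, Y (x i)) P ≤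
      1 / m * ∫ z, Y z ^ 2 ∂ν := by
    rw [variance_const_mul]
    have h1 := variance_sum_pi (μ := fun _ : Fin m => ν) (X := fun _ => Y) fun _ => hY
    have h2 : (∑ i : Fin m, fun ω : Fin m → E => Y (ω i)) = fun ω => ∑ i, Y (ω i) := by
      funext ω; simp
    rw [h2] at h1
    rw [h1, Finset.sum_const, Finset.card_univ, Fintype.card_fin, nsmul_eq_mul]
    have h3 : variance Y ν ≤ ∫ z, Y z ^ 2 ∂ν := variance_le_expectation_sq hY.1
    calc _ = 1 / m * variance Y ν := by field_simp
      _ ≤ _ := by gcongr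
  rw [hev, ← hX.ofReal_variance_eq]
  refine (ENNReal.ofReal_le_ofReal hvar).trans (le_of_eq ?_)
  rw [ENNReal.ofReal_mul (by positivity),
    ofReal_integral_eq_lintegral_ofReal hY.integrable_sq (ae_of_all _ fun z => sq_nonneg _)]
  congr 1
  refine lintegral_congr fun z => ?_
  rw [← sq_abs, ENNReal.ofReal_pow (abs_nonneg _), ← Real.norm_eq_abs, ofReal_norm]

/-- Splitting a sample of size `m + n` into its first `m` and last `n` points. -/
lemma measurePreserving_split {E : Type*} [MeasurableSpace E] (ν : Measure E) [SigmaFinite ν]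
    (m n : ℕ) : MeasurePreserving (fun x : Fin (m + n) → E =>
      ((fun i => x (Fin.castAdd n i) : Fin m → E), (fun i => x (Fin.natAdd m i) : Fin n → E)))
      (Measure.pi fun _ => ν) ((Measure.pi fun _ => ν).prod (Measure.pi fun _ => ν)) := by
  have h1 := (measurePreserving_piCongrLeft (fun _ : Fin (m + n) => ν)
    (finSumFinEquiv (m := m) (n := n))).symm
  have h2 := measurePreserving_sumPiEquivProdPi (fun _ : Fin m ⊕ Fin n => ν)
  have h3 := h2.comp h1
  exact h3

end SampleMean

/-! ### Distributions with a bounded density. -/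

section Laws

variable {d : ℕ}

lemma law_le_smul {ρ : (Fin d → ℝ) → ℝ} {c : ℝ} (h : ∀ x ∈ cube d, ρ x ≤ c) :
    law ρ ≤ ENNReal.ofReal c • cubeMeasure d := by
  rw [← withDensity_const]
  refine withDensity_mono ?_
  filter_upwards [ae_restrict_mem (measurableSet_Icc : MeasurableSet (cube d))] with x hx
  exact ENNReal.ofReal_le_ofReal (h x hx)

lemma IsDensity.isProbabilityMeasure {ρ : (Fin d → ℝ) → ℝ} (h : IsDensity ρ) :
    IsProbabilityMeasure (law ρ) :=
  ⟨by rw [law, withDensity_apply _ MeasurableSet.univ, Measure.restrict_univ, h.2.2]⟩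

lemma integral_law {ρ : (Fin d → ℝ) → ℝ} (h : IsDensity ρ) (g : (Fin d → ℝ) → ℝ) :
    ∫ z, g z ∂(law ρ) = ∫ z, ρ z * g z ∂(cubeMeasure d) := by
  rw [law, integral_withDensity_eq_integral_toReal_smul h.1.ennreal_ofReal
    (ae_of_all _ fun _ => ENNReal.ofReal_lt_top)]
  refine integral_congr_ae ?_
  filter_upwards [ae_restrict_mem (measurableSet_Icc : MeasurableSet (cube d))] with x hx
  rw [ENNReal.toReal_ofReal (h.2.1 x hx), smul_eq_mul]

lemma law_absolutelyContinuous (ρ : (Fin d → ℝ) → ℝ) : law ρ ≪ cubeMeasure d :=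
  withDensity_absolutelyContinuous _ _

end Laws

/-! ### Unbiasedness and mean square error of the two-stage estimator. -/

section TwoStage

variable {d : ℕ}

/-- For a fixed first half, the deviation from the target moment is a centred sample mean. Its
variance is bounded through `w ≤ B` and the bound `b'` on the source density; integrating over the
first half and using Cauchy–Schwarz gives the mean absolute error. -/
lemma twoStage_l2_bound {q m : ℕ} (hm : 1 ≤ m) {b b' B S : ℝ} (hb : 0 < b)
    (hB : 1 ≤ B) {f p₀ pT : (Fin d → ℝ) → ℝ} (hp₀ : IsDensity p₀) (hpT : IsDensity pT)
    (hbd : ∀ x ∈ cube d, b ≤ p₀ x ∧ p₀ x ≤ b') (hw : ∀ x ∈ cube d, ratio p₀ pT x ≤ B)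
    (hf : Measurable f) (hfq : Integrable (fun z => f z ^ q) (cubeMeasure d))
    {F : (Fin m → (Fin d → ℝ)) → (Fin d → ℝ) → ℝ} (hF : Measurable (Function.uncurry F))
    (hS : ∫⁻ x, ∫⁻ z, ‖f z ^ q - F x z ^ q‖ₑ ^ 2 ∂(cubeMeasure d) ∂(sampleLaw p₀ m) ≤
      ENNReal.ofReal S) :
    Integrable (fun t : (Fin m → (Fin d → ℝ)) × (Fin m → (Fin d → ℝ)) =>
      moment q pT (F t.1) + 1 / (m : ℝ) * ∑ i, ratio p₀ pT (t.2 i) *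
        (f (t.2 i) ^ q - F t.1 (t.2 i) ^ q)) ((sampleLaw p₀ m).prod (sampleLaw p₀ m)) ∧
    ∫ t : (Fin m → (Fin d → ℝ)) × (Fin m → (Fin d → ℝ)),
      moment q pT (F t.1) + 1 / (m : ℝ) * ∑ i, ratio p₀ pT (t.2 i) *
        (f (t.2 i) ^ q - F t.1 (t.2 i) ^ q) ∂((sampleLaw p₀ m).prod (sampleLaw p₀ m)) =
      moment q pT f ∧
    ∫ t : (Fin m → (Fin d → ℝ)) × (Fin m → (Fin d → ℝ)),
      |moment q pT (F t.1) + 1 / (m : ℝ) * ∑ i, ratio p₀ pT (t.2 i) *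
        (f (t.2 i) ^ q - F t.1 (t.2 i) ^ q) - moment q pT f|
          ∂((sampleLaw p₀ m).prod (sampleLaw p₀ m)) ≤
      √(B ^ 2 * b' / m * S) := by
  have := hp₀.isProbabilityMeasure
  have := hpT.isProbabilityMeasure
  have : IsProbabilityMeasure (sampleLaw p₀ m) := by unfold sampleLaw; infer_instance
  have hm0 : (0 : ℝ) < m := by exact_mod_cast hm
  have hcube : MeasurableSet (cube d) := measurableSet_Icc
  have hb' : 0 < b' := by
    have h0 : (0 : Fin d → ℝ) ∈ cube d := mem_cube_iff.2 fun i => by simp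
    linarith [(hbd 0 h0).1, (hbd 0 h0).2]
  have hw0 : ∀ x ∈ cube d, 0 ≤ ratio p₀ pT x := fun x hx =>
    div_nonneg (hpT.2.1 x hx) (hb.le.trans (hbd x hx).1)
  have hpTle : ∀ x ∈ cube d, pT x ≤ B * b' := by
    intro x hx
    have hpos : 0 < p₀ x := hb.trans_le (hbd x hx).1
    have h1 := hw x hx
    rw [ratio, div_le_iff₀ hpos] at h1
    exact h1.trans (mul_le_mul_of_nonneg_left (hbd x hx).2 (by linarith))
  have hwm : Measurable (ratio p₀ pT) := hpT.1.div hp₀.1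
  set H : (Fin m → (Fin d → ℝ)) × (Fin m → (Fin d → ℝ)) → ℝ := fun t =>
    moment q pT (F t.1) + 1 / (m : ℝ) * ∑ i, ratio p₀ pT (t.2 i) *
        (f (t.2 i) ^ q - F t.1 (t.2 i) ^ q) with hH
  have hHm : Measurable H := by
    refine Measurable.add ?_ (measurable_const.mul (Finset.measurable_fun_sum _ fun i _ => ?_))
    · have : StronglyMeasurable fun x => ∫ z, F x z ^ q ∂(law pT) :=
        StronglyMeasurable.integral_prod_right
          (f := fun x z => F x z ^ q) (hF.pow_const q).stronglyMeasurable
      exact this.measurable.comp measurable_fst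
    · have hi : Measurable fun t : (Fin m → (Fin d → ℝ)) × (Fin m → (Fin d → ℝ)) => t.2 i :=
        (measurable_pi_apply i).comp measurable_snd
      exact (hwm.comp hi).mul (((hf.comp hi).pow_const q).sub
        ((hF.comp (measurable_fst.prodMk hi)).pow_const q))
  have hgm : Measurable fun t : (Fin m → (Fin d → ℝ)) × (Fin d → ℝ) =>
      ‖f t.2 ^ q - F t.1 t.2 ^ q‖ₑ ^ 2 :=
    ((((hf.comp measurable_snd).pow_const q).sub (hF.pow_const q)).enorm).pow_const 2
  -- The moment of `F x` could be the default integral of a non-integrable function only for `x` in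
  -- a null set.
  have hgood : ∀ᵐ x ∂(sampleLaw p₀ m),
      ∫⁻ z, ‖f z ^ q - F x z ^ q‖ₑ ^ 2 ∂(cubeMeasure d) < ⊤ :=
    ae_lt_top hgm.lintegral_prod_right' (ne_top_of_le_ne_top ENNReal.ofReal_ne_top hS)
  have hcond : ∀ x, ∫⁻ z, ‖f z ^ q - F x z ^ q‖ₑ ^ 2 ∂(cubeMeasure d) < ⊤ →
      ∫ y, H (x, y) ∂(sampleLaw p₀ m) = moment q pT f ∧
      ∫⁻ y, ‖H (x, y) - moment q pT f‖ₑ ^ 2 ∂(sampleLaw p₀ m) ≤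
        ENNReal.ofReal (B ^ 2 * b' / m) * ∫⁻ z, ‖f z ^ q - F x z ^ q‖ₑ ^ 2 ∂(cubeMeasure d) := by
    intro x hx
    set g : (Fin d → ℝ) → ℝ := fun z => f z ^ q - F x z ^ q with hg
    have hgmeas : Measurable g :=
      (hf.pow_const q).sub ((hF.comp measurable_prodMk_left).pow_const q)
    have hg2 : MemLp g 2 (cubeMeasure d) := by
      refine ⟨hgmeas.aestronglyMeasurable, ?_⟩
      rw [eLpNorm_lt_top_iff_lintegral_rpow_enorm_lt_top two_ne_zero ENNReal.ofNat_ne_top]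
      simpa using hx
    have hgT : Integrable g (law pT) :=
      (hg2.of_measure_le_smul ENNReal.ofReal_ne_top (law_le_smul hpTle)).integrable one_le_two
    have hfT : Integrable (fun z => f z ^ q) (law pT) := by
      rw [← memLp_one_iff_integrable] at hfq ⊢
      exact hfq.of_measure_le_smul ENNReal.ofReal_ne_top (law_le_smul hpTle)
    have hFT : moment q pT (F x) = moment q pT f - ∫ z, g z ∂(law pT) := by
      unfold moment
      rw [← integral_sub hfT hgT]
      simp [hg]
    set Y : (Fin d → ℝ) → ℝ := fun z => ratio p₀ pT z * g z with hYdef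
    have hYle : ∀ᵐ z ∂(cubeMeasure d), ‖Y z‖ ≤ B * ‖g z‖ := by
      filter_upwards [ae_restrict_mem hcube] with z hz
      rw [hYdef, norm_mul, Real.norm_of_nonneg (hw0 z hz)]
      exact mul_le_mul_of_nonneg_right (hw z hz) (norm_nonneg _)
    have hY : MemLp Y 2 (law p₀) :=
      (hg2.of_le_mul (hwm.mul hgmeas).aestronglyMeasurable hYle).of_measure_le_smul
        ENNReal.ofReal_ne_top (law_le_smul fun z hz => (hbd z hz).2)
    -- Importance weighting, the source of unbiasedness.
    have hYint : ∫ z, Y z ∂(law p₀) = ∫ z, g z ∂(law pT) := by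
      rw [integral_law hp₀, integral_law hpT]
      refine integral_congr_ae ?_
      filter_upwards [ae_restrict_mem hcube] with z hz
      have hpos : 0 < p₀ z := hb.trans_le (hbd z hz).1
      simp only [hYdef, ratio]
      field_simp
    have hY2 : ∫⁻ z, ‖Y z‖ₑ ^ 2 ∂(law p₀) ≤
        ENNReal.ofReal (B ^ 2 * b') * ∫⁻ z, ‖g z‖ₑ ^ 2 ∂(cubeMeasure d) := by
      calc ∫⁻ z, ‖Y z‖ₑ ^ 2 ∂(law p₀)
          ≤ ∫⁻ z, ‖Y z‖ₑ ^ 2 ∂(ENNReal.ofReal b' • cubeMeasure d) :=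
            lintegral_mono' (law_le_smul fun z hz => (hbd z hz).2) le_rfl
        _ = ENNReal.ofReal b' * ∫⁻ z, ‖Y z‖ₑ ^ 2 ∂(cubeMeasure d) := by
            rw [lintegral_smul_measure, smul_eq_mul]
        _ ≤ ENNReal.ofReal b' * ∫⁻ z, ENNReal.ofReal (B ^ 2) * ‖g z‖ₑ ^ 2 ∂(cubeMeasure d) := by
            gcongr ENNReal.ofReal b' * ?_
            refine lintegral_mono_ae ?_
            filter_upwards [hYle] with z hz
            rw [ENNReal.ofReal_pow (by linarith), ← mul_pow, ← ofReal_norm, ← ofReal_norm,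
              ← ENNReal.ofReal_mul (by linarith)]
            gcongr
        _ = _ := by
            rw [lintegral_const_mul' _ _ ENNReal.ofReal_ne_top, ← mul_assoc,
              ← ENNReal.ofReal_mul hb'.le, mul_comm b']
    obtain ⟨s1, s2, s3⟩ := sampleMean_estimates hY hm
    change Integrable _ (sampleLaw p₀ m) at s1
    change ∫ y, _ ∂(sampleLaw p₀ m) = _ at s2
    have hHx : ∀ y, H (x, y) = moment q pT (F x) + 1 / (m : ℝ) * ∑ i, Y (y i) := fun y => rfl
    constructor
    · simp_rw [hHx]
      rw [integral_add (integrable_const _) s1, integral_const]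
      rw [probReal_univ, one_smul, s2, hFT, hYint]
      ring
    · have : ∀ y, H (x, y) - moment q pT f = 1 / (m : ℝ) * ∑ i, Y (y i) - ∫ z, Y z ∂(law p₀) := by
        intro y
        rw [hHx, hFT, hYint]; ring
      simp_rw [this]
      refine s3.trans ?_
      calc _ ≤ ENNReal.ofReal (1 / m) *
            (ENNReal.ofReal (B ^ 2 * b') * ∫⁻ z, ‖g z‖ₑ ^ 2 ∂(cubeMeasure d)) := by gcongr
        _ = _ := by
            rw [← mul_assoc, ← ENNReal.ofReal_mul (by positivity)]
            congr 2
            ring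
  have hL2 : ∫⁻ t, ‖H t - moment q pT f‖ₑ ^ 2 ∂((sampleLaw p₀ m).prod (sampleLaw p₀ m)) ≤
      ENNReal.ofReal (B ^ 2 * b' / m * S) := by
    rw [lintegral_prod _ ((hHm.sub_const _).enorm.pow_const 2).aemeasurable]
    calc _ ≤ ∫⁻ x, ENNReal.ofReal (B ^ 2 * b' / m) *
          ∫⁻ z, ‖f z ^ q - F x z ^ q‖ₑ ^ 2 ∂(cubeMeasure d) ∂(sampleLaw p₀ m) := by
          refine lintegral_mono_ae ?_
          filter_upwards [hgood] with x hx using (hcond x hx).2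
      _ ≤ _ := by
          rw [lintegral_const_mul' _ _ ENNReal.ofReal_ne_top, ENNReal.ofReal_mul (by positivity)]
          gcongr
  have hnorm : eLpNorm (fun t => H t - moment q pT f) 2
      ((sampleLaw p₀ m).prod (sampleLaw p₀ m)) ≤ ENNReal.ofReal (√(B ^ 2 * b' / m * S)) := by
    rw [eLpNorm_eq_lintegral_rpow_enorm_toReal two_ne_zero ENNReal.ofNat_ne_top]
    simp only [ENNReal.toReal_ofNat, ENNReal.rpow_ofNat]
    rw [one_div, ENNReal.rpow_inv_le_iff two_pos]
    refine hL2.trans ?_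
    rw [ENNReal.rpow_two, ← ENNReal.ofReal_pow (Real.sqrt_nonneg _)]
    rcases le_or_gt 0 (B ^ 2 * b' / m * S) with h | h
    · rw [Real.sq_sqrt h]
    · rw [ENNReal.ofReal_of_nonpos h.le]; exact zero_le
  have hmem : MemLp (fun t => H t - moment q pT f) 2 ((sampleLaw p₀ m).prod (sampleLaw p₀ m)) :=
    ⟨(hHm.sub_const _).aestronglyMeasurable, hnorm.trans_lt ENNReal.ofReal_lt_top⟩
  have hint : Integrable H ((sampleLaw p₀ m).prod (sampleLaw p₀ m)) := by
    have := (hmem.integrable one_le_two).add (integrable_const (moment q pT f))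
    refine this.congr (ae_of_all _ fun t => ?_)
    simp
  refine ⟨hint, ?_, ?_⟩
  · rw [integral_prod _ hint]
    have : ∀ᵐ x ∂(sampleLaw p₀ m), ∫ y, H (x, y) ∂(sampleLaw p₀ m) = moment q pT f := by
      filter_upwards [hgood] with x hx using (hcond x hx).1
    rw [integral_congr_ae this, integral_const]
    simp
  · have h1 := (eLpNorm_le_eLpNorm_of_exponent_le (μ := (sampleLaw p₀ m).prod (sampleLaw p₀ m))
      (one_le_two : (1 : ENNReal) ≤ 2) hmem.1).trans hnorm
    have h2 : ENNReal.ofReal (∫ t, |H t - moment q pT f|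
        ∂((sampleLaw p₀ m).prod (sampleLaw p₀ m))) ≤ ENNReal.ofReal (√(B ^ 2 * b' / m * S)) := by
      refine le_trans (le_of_eq ?_) h1
      rw [eLpNorm_one_eq_lintegral_enorm,
        ofReal_integral_eq_lintegral_ofReal (hmem.integrable one_le_two).abs
          (ae_of_all _ fun t => abs_nonneg _)]
      refine lintegral_congr fun t => ?_
      rw [← Real.norm_eq_abs, ofReal_norm]
    exact (ENNReal.ofReal_le_ofReal_iff (Real.sqrt_nonneg _)).1 h2

end TwoStage

/-! ### Differences of powers and the three-term Hölder inequality. -/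

section Moments

/-- The factor `max |a| |b|` is at most `|a| + |b - a|`. In this form the estimate `b` enters only
through its error, so no moment of the estimate itself is needed. -/
lemma abs_pow_sub_pow_le_add {q : ℕ} (hq : 1 ≤ q) (a b : ℝ) :
    |a ^ q - b ^ q| ≤ q * 2 ^ q * (|a| ^ (q - 1) * |b - a| + |b - a| ^ q) := by
  have h1 := abs_pow_sub_pow_le a b q
  have h2 : max |a| |b| ≤ |a| + |b - a| := by
    refine max_le (by linarith [abs_nonneg (b - a)]) ?_
    have := abs_add_le a (b - a)
    rwa [add_sub_cancel] at this
  have h3 : max |a| |b| ^ (q - 1) ≤ 2 ^ q * (|a| ^ (q - 1) + |b - a| ^ (q - 1)) := by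
    calc _ ≤ (|a| + |b - a|) ^ (q - 1) := by gcongr
      _ ≤ 2 ^ (q - 1 - 1) * (|a| ^ (q - 1) + |b - a| ^ (q - 1)) :=
          add_pow_le (abs_nonneg _) (abs_nonneg _) _
      _ ≤ _ := by
          gcongr
          · norm_num
          · omega
  calc |a ^ q - b ^ q| ≤ |a - b| * q * max |a| |b| ^ (q - 1) := h1
    _ ≤ |a - b| * q * (2 ^ q * (|a| ^ (q - 1) + |b - a| ^ (q - 1))) := by gcongr
    _ = q * 2 ^ q * (|a| ^ (q - 1) * |b - a| + |b - a| ^ (q - 1) * |b - a|) := by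
        rw [abs_sub_comm a b]; ring
    _ = _ := by rw [← pow_succ, Nat.sub_add_cancel hq]

lemma enorm_pow_sub_pow_sq_le {q : ℕ} (hq : 1 ≤ q) (a b : ℝ) :
    ‖a ^ q - b ^ q‖ₑ ^ 2 ≤ ENNReal.ofReal (2 * (q * 2 ^ q) ^ 2) *
      (‖a‖ₑ ^ (2 * (q - 1)) * ‖b - a‖ₑ ^ 2 + ‖b - a‖ₑ ^ (2 * q)) := by
  have h := abs_pow_sub_pow_le_add hq a b
  have h2 : |a ^ q - b ^ q| ^ 2 ≤ 2 * (q * 2 ^ q) ^ 2 *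
      (|a| ^ (2 * (q - 1)) * |b - a| ^ 2 + |b - a| ^ (2 * q)) := by
    calc _ ≤ (q * 2 ^ q * (|a| ^ (q - 1) * |b - a| + |b - a| ^ q)) ^ 2 := by gcongr
      _ = (q * 2 ^ q) ^ 2 * (|a| ^ (q - 1) * |b - a| + |b - a| ^ q) ^ 2 := by ring
      _ ≤ (q * 2 ^ q) ^ 2 * (2 * ((|a| ^ (q - 1) * |b - a|) ^ 2 + (|b - a| ^ q) ^ 2)) := by
          gcongr
          exact add_sq_le
      _ = _ := by ring
  have he : ∀ x : ℝ, ‖x‖ₑ = ENNReal.ofReal |x| := fun x => by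
    rw [← ofReal_norm, Real.norm_eq_abs]
  rw [he, he, he, ← ENNReal.ofReal_pow (abs_nonneg _), ← ENNReal.ofReal_pow (abs_nonneg _),
    ← ENNReal.ofReal_pow (abs_nonneg _), ← ENNReal.ofReal_pow (abs_nonneg _),
    ← ENNReal.ofReal_mul (by positivity), ← ENNReal.ofReal_add (by positivity) (by positivity),
    ← ENNReal.ofReal_mul (by positivity)]
  exact ENNReal.ofReal_le_ofReal h2

variable {X E : Type*} [MeasurableSpace X] [MeasurableSpace E] {P : Measure X} {μ : Measure E}
  [IsProbabilityMeasure P] [SFinite μ]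

lemma lintegral_rpow_mul_rpow_le {f : E → ENNReal} {h : X × E → ENNReal} (hf : Measurable f)
    (hh : Measurable h) {a₀ a₁ a₂ v r₀ r₁ : ℝ} (h₀ : 0 ≤ a₀) (h₁ : 0 ≤ a₁) (h₂ : 0 ≤ a₂)
    (hr₀ : 0 ≤ r₀) (hr₁ : 0 ≤ r₁) (hsum : a₀ + a₁ + a₂ = 1) :
    ∫⁻ t, f t.2 ^ (v * a₀) * h t ^ (r₀ * a₁ + r₁ * a₂) ∂(P.prod μ) ≤
      (∫⁻ z, f z ^ v ∂μ) ^ a₀ * (∫⁻ t, h t ^ r₀ ∂(P.prod μ)) ^ a₁ *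
        (∫⁻ t, h t ^ r₁ ∂(P.prod μ)) ^ a₂ := by
  have key := ENNReal.lintegral_prod_norm_pow_le (μ := P.prod μ) (Finset.univ : Finset (Fin 3))
    (f := ![fun t => f t.2 ^ v, fun t => h t ^ r₀, fun t => h t ^ r₁])
    (by
      intro i _
      fin_cases i
      · exact ((hf.comp measurable_snd).pow_const v).aemeasurable
      · exact (hh.pow_const r₀).aemeasurable
      · exact (hh.pow_const r₁).aemeasurable)
    (p := ![a₀, a₁, a₂]) (by simp [Fin.sum_univ_three, hsum])
    (by intro i _; fin_cases i <;> simpa)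
  simp only [Fin.prod_univ_three, Matrix.cons_val_zero, Matrix.cons_val_one, Matrix.cons_val] at key
  have hprod : ∫⁻ t, f t.2 ^ v ∂(P.prod μ) = ∫⁻ z, f z ^ v ∂μ := by
    rw [lintegral_prod (fun t : X × E => f t.2 ^ v)
      ((hf.comp measurable_snd).pow_const v).aemeasurable]
    simp
  rw [hprod] at key
  refine le_trans (le_of_eq (lintegral_congr fun t => ?_)) key
  rw [← ENNReal.rpow_mul, ← ENNReal.rpow_mul, ← ENNReal.rpow_mul,
    ENNReal.rpow_add_of_nonneg _ _ (by positivity) (by positivity), mul_assoc]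

/-- Second moment of `f ^ q - F ^ q` from the moments of `F - f` and the integrability of `f`. -/
lemma lintegral_pow_sub_pow_sq_le {q : ℕ} (hq : 1 ≤ q) {f : E → ℝ} {F : X → E → ℝ}
    (hf : Measurable f) (hF : Measurable (Function.uncurry F))
    {a₀ a₁ a₂ v r₀ Φ Y₀ Y₁ : ℝ} (h₀ : 0 ≤ a₀) (h₁ : 0 ≤ a₁) (h₂ : 0 ≤ a₂) (hv : 0 < v)
    (hr₀ : 0 ≤ r₀) (hsum : a₀ + a₁ + a₂ = 1) (hva : v * a₀ = 2 * ((q : ℝ) - 1))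
    (hra : r₀ * a₁ + 2 * q * a₂ = 2) (hΦ : 0 ≤ Φ) (hY₀ : 0 ≤ Y₀) (hY₁ : 0 ≤ Y₁)
    (hfΦ : eLpNorm f (ENNReal.ofReal v) μ ≤ ENNReal.ofReal Φ)
    (hX₀ : ∫⁻ x, ∫⁻ z, ‖F x z - f z‖ₑ ^ r₀ ∂μ ∂P ≤ ENNReal.ofReal Y₀)
    (hX₁ : ∫⁻ x, ∫⁻ z, ‖F x z - f z‖ₑ ^ (2 * q : ℝ) ∂μ ∂P ≤ ENNReal.ofReal Y₁) :
    ∫⁻ x, ∫⁻ z, ‖f z ^ q - F x z ^ q‖ₑ ^ 2 ∂μ ∂P ≤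
      ENNReal.ofReal (2 * (q * 2 ^ q) ^ 2 * (Φ ^ (2 * (q - 1)) * (Y₀ ^ a₁ * Y₁ ^ a₂) + Y₁)) := by
  set h : X × E → ENNReal := fun t => ‖F t.1 t.2 - f t.2‖ₑ with hh
  have hhm : Measurable h := (hF.sub (hf.comp measurable_snd)).enorm
  have hI : ∀ r : ℝ, ∫⁻ t, h t ^ r ∂(P.prod μ) = ∫⁻ x, ∫⁻ z, ‖F x z - f z‖ₑ ^ r ∂μ ∂P := fun r =>
    lintegral_prod _ (hhm.pow_const r).aemeasurable
  have hgm : Measurable fun t : X × E => ‖f t.2 ^ q - F t.1 t.2 ^ q‖ₑ ^ 2 :=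
    ((((hf.comp measurable_snd).pow_const q).sub (hF.pow_const q)).enorm).pow_const 2
  have hcast : (2 * ((q : ℝ) - 1)) = ((2 * (q - 1) : ℕ) : ℝ) := by
    rw [Nat.cast_mul, Nat.cast_sub hq]; norm_num
  have hfv : (∫⁻ z, ‖f z‖ₑ ^ v ∂μ) ^ a₀ ≤ ENNReal.ofReal (Φ ^ (2 * (q - 1))) := by
    rw [eLpNorm_ofReal_eq hv, one_div, ENNReal.rpow_inv_le_iff hv] at hfΦ
    calc _ ≤ (ENNReal.ofReal Φ ^ v) ^ a₀ := by gcongr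
      _ = _ := by
        rw [← ENNReal.rpow_mul, hva, hcast, ENNReal.rpow_natCast, ENNReal.ofReal_pow hΦ]
  have hA : ∫⁻ t, ‖f t.2‖ₑ ^ (2 * (q - 1)) * h t ^ 2 ∂(P.prod μ) ≤
      ENNReal.ofReal (Φ ^ (2 * (q - 1)) * (Y₀ ^ a₁ * Y₁ ^ a₂)) := by
    have := lintegral_rpow_mul_rpow_le (P := P) (μ := μ) (f := fun z => ‖f z‖ₑ) hf.enorm hhm h₀ h₁
      h₂ hr₀ (by positivity : (0 : ℝ) ≤ 2 * q) hsum (v := v)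
    rw [hva, hra, hI, hI] at this
    rw [hcast] at this
    simp only [ENNReal.rpow_natCast, ENNReal.rpow_two] at this
    refine this.trans ?_
    rw [ENNReal.ofReal_mul (by positivity), ENNReal.ofReal_mul (by positivity),
      ← ENNReal.ofReal_rpow_of_nonneg hY₀ h₁, ← ENNReal.ofReal_rpow_of_nonneg hY₁ h₂, ← mul_assoc]
    gcongr
  calc _ = ∫⁻ t, ‖f t.2 ^ q - F t.1 t.2 ^ q‖ₑ ^ 2 ∂(P.prod μ) :=
        (lintegral_prod _ hgm.aemeasurable).symm
    _ ≤ ∫⁻ t, ENNReal.ofReal (2 * (q * 2 ^ q) ^ 2) *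
        (‖f t.2‖ₑ ^ (2 * (q - 1)) * h t ^ 2 + h t ^ (2 * q)) ∂(P.prod μ) :=
        lintegral_mono fun t => enorm_pow_sub_pow_sq_le hq _ _
    _ = ENNReal.ofReal (2 * (q * 2 ^ q) ^ 2) *
        (∫⁻ t, ‖f t.2‖ₑ ^ (2 * (q - 1)) * h t ^ 2 ∂(P.prod μ) +
          ∫⁻ t, h t ^ (2 * q) ∂(P.prod μ)) := by
        rw [lintegral_const_mul' _ _ ENNReal.ofReal_ne_top,
          lintegral_add_right _ (hhm.pow_const _)]
    _ ≤ ENNReal.ofReal (2 * (q * 2 ^ q) ^ 2) *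
        (ENNReal.ofReal (Φ ^ (2 * (q - 1)) * (Y₀ ^ a₁ * Y₁ ^ a₂)) + ENNReal.ofReal Y₁) := by
        gcongr
        refine le_trans (le_of_eq ?_) hX₁
        rw [← hI]
        refine lintegral_congr fun t => ?_
        rw [← ENNReal.rpow_natCast]
        norm_num
    _ = _ := by
        rw [← ENNReal.ofReal_add (by positivity) hY₁, ← ENNReal.ofReal_mul (by positivity)]

/-- Choice of the exponents in the three-term Hölder inequality. -/
lemma exists_holder_exponents {q r₀ T : ℝ} (hq : 1 ≤ q) (hr₀ : 2 ≤ r₀) (hr₀q : r₀ ≤ 2 * q)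
    (hT : T ≤ 1 / (2 * q)) : ∃ β θ : ℝ, T ≤ β ∧ β ≤ 1 / (2 * q) ∧ 0 ≤ θ ∧ θ ≤ 1 ∧
      2 * (q - 1) * β + 2 * (1 - θ) / r₀ + θ / q = 1 ∧
      θ * (1 / r₀ - 1 / (2 * q)) ≤ max 0 ((q - 1) * T + 1 / r₀ - 1 / 2) := by
  have hq0 : 0 < q := by linarith
  have hr0 : 0 < r₀ := by linarith
  have hinv : 1 / (2 * q) ≤ 1 / r₀ := one_div_le_one_div_of_le hr0 hr₀q
  have hq2 : 1 / q = 2 * (1 / (2 * q)) := by field_simp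
  have hqq : q * (1 / (2 * q)) = 1 / 2 := by field_simp
  -- At `β = T` and `θ = 0` the Hölder weights may sum to at most one or to more. If at most one, no
  -- error at exponent `2q` is needed and, for `q > 1`, `β` is raised until the sum is one; for `q =
  -- 1` necessarily `r₀ = 2`, and `β` plays no role in the sum.
  by_cases hcase : 2 * (q - 1) * T + 2 * (1 / r₀) ≤ 1
  · rcases hq.eq_or_lt with h1 | h1
    · have : r₀ = 2 := by linarith
      subst h1 this
      refine ⟨T, 0, le_rfl, hT, le_rfl, zero_le_one, by norm_num, by simp⟩
    · have hq1 : 0 < q - 1 := by linarith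
      refine ⟨(1 / 2 - 1 / r₀) / (q - 1), 0, ?_, ?_, le_rfl, zero_le_one, ?_, by simp⟩
      · rw [le_div_iff₀ hq1]; linarith
      · rw [div_le_iff₀ hq1]; nlinarith
      · field_simp
        ring
  · push Not at hcase
    have hle : 2 * (q - 1) * T ≤ 1 - 1 / q := by
      have : 2 * (q - 1) * T ≤ 2 * (q - 1) * (1 / (2 * q)) :=
        mul_le_mul_of_nonneg_left hT (by linarith)
      linarith
    have hden : 0 < 2 * (1 / r₀) - 1 / q := by linarith
    -- Here the weights exceed one at `θ = 0`; `β` stays at `T`, and `θ`, the share of the error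
    -- moved from `r₀` to `2q`, solves the linear equation.
    set θ := (2 * (q - 1) * T + 2 * (1 / r₀) - 1) / (2 * (1 / r₀) - 1 / q) with hθ
    have hθd : θ * (2 * (1 / r₀) - 1 / q) = 2 * (q - 1) * T + 2 * (1 / r₀) - 1 :=
      div_mul_cancel₀ _ hden.ne'
    refine ⟨T, θ, le_rfl, hT, div_nonneg (by linarith) hden.le, ?_, ?_, ?_⟩
    · rw [hθ, div_le_one hden]; linarith
    · have e1 : 2 * (1 - θ) / r₀ = 2 * (1 - θ) * (1 / r₀) := by ring
      have e2 : θ / q = θ * (1 / q) := by ring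
      rw [e1, e2]; linarith
    · refine le_max_of_le_right ?_
      rw [hq2] at hθd
      linarith

end Moments

/-! ### Transfer of the oracle rate to a measurable representative. -/

section Oracle

variable {d : ℕ}

lemma ae_sampleLaw_of_ae {p₀ : (Fin d → ℝ) → ℝ} (hp₀ : IsDensity p₀) {n : ℕ}
    {Q : (Fin d → ℝ) → Prop} (h : ∀ᵐ z ∂(cubeMeasure d), Q z) :
    ∀ᵐ x ∂(sampleLaw p₀ n), ∀ i, Q (x i) := by
  have := hp₀.isProbabilityMeasure
  rw [ae_all_iff]
  intro i
  exact (measurePreserving_eval (fun _ : Fin n => law p₀) i).quasiMeasurePreserving.ae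
    ((law_absolutelyContinuous p₀).ae_le h)

/-- The rate is raised to the power `r`. Replacing `f` by `f₀` changes neither the data nor the
error almost surely, since the sampling law is absolutely continuous. -/
lemma OracleRate.lintegral_le {s m : ℕ} {p r U D : ℝ} {c A k : ℝ → ℝ}
    {f f₀ p₀ : (Fin d → ℝ) → ℝ} {K : FunEstimator d} (h : OracleRate s p c A k f p₀ K)
    (hp₀ : IsDensity p₀) (hff₀ : f =ᵐ[cubeMeasure d] f₀) (hm : 1 ≤ m)
    (hr : AdmissibleExponent d s p r) (hU : A r * (1 + Real.log m) ^ (k r) ≤ U) (hU0 : 0 ≤ U)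
    (hc : 0 ≤ c r) (hcD : c r ^ r ≤ D) :
    ∫⁻ x, ∫⁻ z, ‖K m x (fun i => f₀ (x i)) z - f₀ z‖ₑ ^ r ∂(cubeMeasure d) ∂(sampleLaw p₀ m) ≤
      ENNReal.ofReal (D * (U * (m : ℝ) ^ (-((s : ℝ) / d) + max (1 / p - 1 / r) 0)) ^ r) := by
  have hr0 : 0 < r := hr.1
  set e := -((s : ℝ) / d) + max (1 / p - 1 / r) 0
  have hme : 0 ≤ (m : ℝ) ^ e := by positivity
  have h1 : ∫⁻ x, eLpNorm (fun z => K m x (fun i => f (x i)) z - f z) (ENNReal.ofReal r)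
      (cubeMeasure d) ^ r ∂(sampleLaw p₀ m) ≤
      ENNReal.ofReal (A r * (1 + Real.log m) ^ (k r) * c r * (m : ℝ) ^ e) ^ r := by
    rw [← ENNReal.rpow_inv_le_iff hr0, inv_eq_one_div]
    exact h r hr m hm
  calc _ = ∫⁻ x, eLpNorm (fun z => K m x (fun i => f (x i)) z - f z) (ENNReal.ofReal r)
        (cubeMeasure d) ^ r ∂(sampleLaw p₀ m) := by
        refine lintegral_congr_ae ?_
        filter_upwards [ae_sampleLaw_of_ae hp₀ hff₀] with x hx
        have hfx : (fun i => f (x i)) = fun i => f₀ (x i) := funext hx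
        rw [eLpNorm_ofReal_eq hr0, ← ENNReal.rpow_mul, one_div_mul_cancel hr0.ne', ENNReal.rpow_one,
          hfx]
        refine lintegral_congr_ae ?_
        filter_upwards [hff₀] with z hz
        rw [hz]
    _ ≤ _ := h1
    _ ≤ ENNReal.ofReal (U * c r * (m : ℝ) ^ e) ^ r := by gcongr
    _ = ENNReal.ofReal ((U * c r * (m : ℝ) ^ e) ^ r) :=
        ENNReal.ofReal_rpow_of_nonneg (by positivity) hr0.le
    _ ≤ _ := by
        apply ENNReal.ofReal_le_ofReal
        rw [show U * c r * (m : ℝ) ^ e = c r * (U * (m : ℝ) ^ e) by ring,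
          Real.mul_rpow hc (by positivity)]
        gcongr

lemma twoStage_eq {q m : ℕ} (p₀ pT f : (Fin d → ℝ) → ℝ) (K : FunEstimator d)
    (x : Fin (m + m) → (Fin d → ℝ)) :
    twoStage q p₀ pT K m x (fun i => f (x i)) =
      moment q pT (K m (fun i => x (Fin.castAdd m i)) (fun i => f (x (Fin.castAdd m i)))) +
        1 / (m : ℝ) * ∑ i : Fin m, ratio p₀ pT (x (Fin.natAdd m i)) *
          (f (x (Fin.natAdd m i)) ^ q -
            K m (fun i => x (Fin.castAdd m i)) (fun i => f (x (Fin.castAdd m i)))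
              (x (Fin.natAdd m i)) ^ q) := by
  unfold twoStage
  have : 2 / ((m + m : ℕ) : ℝ) = 1 / (m : ℝ) := by
    push_cast
    rw [← two_mul, div_mul_eq_div_div, div_self two_ne_zero]
  rw [this]

/-- The error of the two-stage estimator, from the second moment of `f ^ q - fhat ^ q`. -/
lemma twoStage_estimates {q m : ℕ} (hm : 1 ≤ m) {b b' B S : ℝ} (hb : 0 < b)
    (hB : 1 ≤ B) {f f₀ p₀ pT : (Fin d → ℝ) → ℝ} {K : FunEstimator d} (hp₀ : IsDensity p₀)
    (hpT : IsDensity pT) (hbd : ∀ x ∈ cube d, b ≤ p₀ x ∧ p₀ x ≤ b')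
    (hw : ∀ x ∈ cube d, ratio p₀ pT x ≤ B) (hff₀ : f =ᵐ[cubeMeasure d] f₀) (hf : Measurable f₀)
    (hfq : Integrable (fun z => f₀ z ^ q) (cubeMeasure d))
    (hK : Measurable (fun t : (Fin m → (Fin d → ℝ)) × (Fin m → ℝ) × (Fin d → ℝ) =>
      K m t.1 t.2.1 t.2.2))
    (hS : ∫⁻ x, ∫⁻ z, ‖f₀ z ^ q - K m x (fun i => f₀ (x i)) z ^ q‖ₑ ^ 2 ∂(cubeMeasure d)
      ∂(sampleLaw p₀ m) ≤ ENNReal.ofReal S) :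
    Integrable (fun x => twoStage q p₀ pT K m x (fun i => f (x i))) (sampleLaw p₀ (m + m)) ∧
    ∫ x, twoStage q p₀ pT K m x (fun i => f (x i)) ∂(sampleLaw p₀ (m + m)) = moment q pT f ∧
    ∫ x, |twoStage q p₀ pT K m x (fun i => f (x i)) - moment q pT f| ∂(sampleLaw p₀ (m + m)) ≤
      √(B ^ 2 * b' / m * S) := by
  have := hp₀.isProbabilityMeasure
  have hF : Measurable (Function.uncurry fun x z => K m x (fun i => f₀ (x i)) z) := by
    refine hK.comp (measurable_fst.prodMk (Measurable.prodMk ?_ measurable_snd))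
    exact measurable_pi_iff.2 fun i => hf.comp ((measurable_pi_apply i).comp measurable_fst)
  obtain ⟨h1, h2, h3⟩ := twoStage_l2_bound hm hb hB hp₀ hpT hbd hw hf hfq hF hS
  have hsplit := measurePreserving_split (law p₀) m m
  have hmom : moment q pT f = moment q pT f₀ := by
    refine integral_congr_ae ?_
    filter_upwards [(law_absolutelyContinuous pT).ae_le hff₀] with z hz
    rw [hz]
  have hae : (fun x => twoStage q p₀ pT K m x (fun i => f (x i))) =ᵐ[sampleLaw p₀ (m + m)]
      fun x => twoStage q p₀ pT K m x (fun i => f₀ (x i)) := by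
    filter_upwards [ae_sampleLaw_of_ae hp₀ hff₀] with x hx
    have hfx : (fun i => f (x i)) = fun i => f₀ (x i) := funext hx
    rw [hfx]
  simp_rw [twoStage_eq] at hae
  set H : (Fin m → (Fin d → ℝ)) × (Fin m → (Fin d → ℝ)) → ℝ := fun t =>
    moment q pT (K m t.1 (fun i => f₀ (t.1 i))) + 1 / (m : ℝ) * ∑ i, ratio p₀ pT (t.2 i) *
        (f₀ (t.2 i) ^ q - K m t.1 (fun i => f₀ (t.1 i)) (t.2 i) ^ q)
  set Ψ : (Fin (m + m) → (Fin d → ℝ)) → (Fin m → (Fin d → ℝ)) × (Fin m → (Fin d → ℝ)) := fun x =>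
    (fun i => x (Fin.castAdd m i), fun i => x (Fin.natAdd m i))
  change MeasurePreserving Ψ (sampleLaw p₀ (m + m)) ((sampleLaw p₀ m).prod (sampleLaw p₀ m))
    at hsplit
  simp_rw [twoStage_eq]
  have hae' : _ =ᵐ[sampleLaw p₀ (m + m)] fun x => H (Ψ x) := hae
  have hint : Integrable (fun x => H (Ψ x)) (sampleLaw p₀ (m + m)) :=
    hsplit.integrable_comp_of_integrable h1
  have hmap : ∀ G : (Fin m → (Fin d → ℝ)) × (Fin m → (Fin d → ℝ)) → ℝ,
      AEStronglyMeasurable G ((sampleLaw p₀ m).prod (sampleLaw p₀ m)) →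
      ∫ x, G (Ψ x) ∂(sampleLaw p₀ (m + m)) = ∫ t, G t ∂((sampleLaw p₀ m).prod (sampleLaw p₀ m)) := by
    intro G hG
    rw [← hsplit.map_eq, integral_map hsplit.aemeasurable]
    rwa [hsplit.map_eq]
  refine ⟨hint.congr hae'.symm, ?_, ?_⟩
  · rw [integral_congr_ae hae', hmap H h1.1, hmom]
    exact h2
  · rw [integral_congr_ae (g := fun x => |H (Ψ x) - moment q pT f₀|)
      (by filter_upwards [hae'] with x hx; rw [hx, hmom]),
      hmap (fun t => |H t - moment q pT f₀|) (h1.1.sub aestronglyMeasurable_const).norm]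
    exact h3

/-- The cube has volume one, so a density of total mass one cannot stay below a constant less than
one. -/
lemma IsDensity.one_le_of_le {ρ : (Fin d → ℝ) → ℝ} (h : IsDensity ρ) {c : ℝ}
    (hc : ∀ x ∈ cube d, ρ x ≤ c) : 1 ≤ c := by
  have h1 := law_le_smul hc univ
  have := h.isProbabilityMeasure
  have hvol : cubeMeasure d univ = 1 := by
    rw [cubeMeasure, Measure.restrict_apply_univ, cube, Real.volume_Icc_pi]
    simp
  rw [measure_univ, Measure.smul_apply, hvol, smul_eq_mul, mul_one] at h1
  rwa [ENNReal.one_le_ofReal] at h1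

end Oracle

/-! ### Powers of the sample size. -/

section Rate

/-- An exponent of order `1 / (1 + log m)` changes a power of `m` by a bounded factor only; this is
what pays for missing the critical Sobolev exponent. -/
lemma rpow_div_one_add_log_le {m : ℕ} (hm : 1 ≤ m) {x y : ℝ} (hx : 0 ≤ x)
    (hxy : y ≤ x / (1 + Real.log m)) : (m : ℝ) ^ y ≤ Real.exp x := by
  have hm1 : (1 : ℝ) ≤ m := by exact_mod_cast hm
  have hlog : 0 ≤ Real.log m := Real.log_nonneg hm1
  rw [Real.rpow_def_of_pos (by linarith)]
  apply Real.exp_le_exp.2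
  calc Real.log m * y ≤ Real.log m * (x / (1 + Real.log m)) := by gcongr
    _ = x * (Real.log m / (1 + Real.log m)) := by ring
    _ ≤ x * 1 := by
        gcongr
        rw [div_le_one (by linarith)]
        linarith
    _ = x := mul_one x

/-- The products of moment bounds at two exponents, weighted as in Hölder's inequality. -/
lemma weighted_moment_bound_le {m : ℕ} (hm : 1 ≤ m) {D U r₀ r₁ a₁ a₂ e₀ e₁ E M : ℝ} (hD : 1 ≤ D)
    (hU : 1 ≤ U) (hle : a₁ + a₂ ≤ 1) (hra : r₀ * a₁ + r₁ * a₂ = 2)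
    (hE : (m : ℝ) ^ (e₀ * (r₀ * a₁) + e₁ * (r₁ * a₂)) ≤ (m : ℝ) ^ E * M) :
    (D * (U * (m : ℝ) ^ e₀) ^ r₀) ^ a₁ * (D * (U * (m : ℝ) ^ e₁) ^ r₁) ^ a₂ ≤
      D * U ^ 2 * ((m : ℝ) ^ E * M) := by
  have hm0 : (0 : ℝ) < m := by exact_mod_cast hm
  have hD0 : 0 < D := by linarith
  have hU0 : 0 < U := by linarith
  have hsplit : ∀ e r a : ℝ, (D * (U * (m : ℝ) ^ e) ^ r) ^ a =
      D ^ a * U ^ (r * a) * (m : ℝ) ^ (e * (r * a)) := by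
    intro e r a
    rw [Real.mul_rpow hD0.le (by positivity), ← Real.rpow_mul (by positivity),
      Real.mul_rpow hU0.le (by positivity), ← Real.rpow_mul hm0.le, mul_assoc]
  rw [hsplit, hsplit]
  calc _ = D ^ (a₁ + a₂) * U ^ (r₀ * a₁ + r₁ * a₂) *
        (m : ℝ) ^ (e₀ * (r₀ * a₁) + e₁ * (r₁ * a₂)) := by
        rw [Real.rpow_add hD0, Real.rpow_add hU0, Real.rpow_add hm0]; ring
    _ ≤ D ^ (1 : ℝ) * U ^ (2 : ℝ) * ((m : ℝ) ^ E * M) := by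
        rw [hra]
        gcongr
    _ = _ := by rw [Real.rpow_one, Real.rpow_two]

/-- The square root of the second-moment bound. -/
lemma sqrt_error_le {m q : ℕ} (hm : 1 ≤ m) (hq : 1 ≤ q) {B b' D U Φ M E Z Y c₀ : ℝ} (hB : 0 ≤ B)
    (hb' : 0 ≤ b') (hD : 0 ≤ D) (hU : 1 ≤ U) (hΦ : 0 ≤ Φ) (hM : 0 ≤ M) (hc₀ : 0 ≤ c₀)
    (hZ : Z ≤ D * U ^ 2 * ((m : ℝ) ^ (2 * E) * M ^ 2))
    (hY : Y ≤ D * U ^ (2 * q) * (m : ℝ) ^ (2 * E)) :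
    √(B ^ 2 * b' / m * (2 * c₀ ^ 2 * (Φ ^ (2 * (q - 1)) * Z + Y))) ≤
      2 * c₀ * U ^ q * (Φ ^ (q - 1) * M + 1) * (B * √(b' * D) * (m : ℝ) ^ (E - 1 / 2)) := by
  have hm0 : (0 : ℝ) < m := by exact_mod_cast hm
  have hU0 : 0 < U := by linarith
  rw [Real.sqrt_le_iff]
  refine ⟨by positivity, ?_⟩
  have hUq : U ^ 2 ≤ U ^ (2 * q) := pow_le_pow_right₀ hU (by omega)
  have hmE : ((m : ℝ) ^ (E - 1 / 2)) ^ 2 = (m : ℝ) ^ (2 * E) / m := by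
    rw [← Real.rpow_natCast, ← Real.rpow_mul hm0.le,
      show (E - 1 / 2) * ((2 : ℕ) : ℝ) = 2 * E - 1 by push_cast; ring, Real.rpow_sub_one hm0.ne']
  have hΦ2 : Φ ^ (2 * (q - 1)) = (Φ ^ (q - 1)) ^ 2 := by rw [← pow_mul, mul_comm]
  have hU2 : U ^ (2 * q) = (U ^ q) ^ 2 := by rw [← pow_mul, mul_comm]
  have hmE0 : 0 ≤ (m : ℝ) ^ (2 * E) := by positivity
  calc B ^ 2 * b' / m * (2 * c₀ ^ 2 * (Φ ^ (2 * (q - 1)) * Z + Y))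
      ≤ B ^ 2 * b' / m * (2 * c₀ ^ 2 * (Φ ^ (2 * (q - 1)) *
        (D * U ^ (2 * q) * ((m : ℝ) ^ (2 * E) * M ^ 2)) +
          D * U ^ (2 * q) * (m : ℝ) ^ (2 * E))) := by
        gcongr
        exact hZ.trans (by gcongr)
    _ = 2 * c₀ ^ 2 * (U ^ q) ^ 2 * ((Φ ^ (q - 1) * M) ^ 2 + 1) * (B ^ 2 * (b' * D) *
        ((m : ℝ) ^ (2 * E) / m)) := by
        rw [hΦ2, hU2]; ring
    _ ≤ 4 * c₀ ^ 2 * (U ^ q) ^ 2 * (Φ ^ (q - 1) * M + 1) ^ 2 * (B ^ 2 * (b' * D) *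
        ((m : ℝ) ^ (2 * E) / m)) := by
        have h1 : (Φ ^ (q - 1) * M) ^ 2 + 1 ≤ (Φ ^ (q - 1) * M + 1) ^ 2 := by
          have : 0 ≤ Φ ^ (q - 1) * M := by positivity
          nlinarith
        gcongr
        norm_num
    _ = _ := by
        rw [← hmE, mul_pow _ (B * √(b' * D) * (m : ℝ) ^ (E - 1 / 2)),
          mul_pow (B * √(b' * D)), mul_pow B, Real.sq_sqrt (by positivity)]
        ring

end Rate

/-! ### Choice of the exponents and assembly of the bound. -/

section Assembly

/-- The exponent at which the oracle rate is used besides `2 q`. -/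
def baseExponent (d s : ℕ) (p : ℝ) : ℝ := if (d : ℝ) / p < s then 2 else p

variable {d s q : ℕ} {p : ℝ}

lemma baseExponent_le (hp : 2 ≤ p) : baseExponent d s p ≤ p := by
  unfold baseExponent; split_ifs <;> linarith

lemma two_le_baseExponent (hp : 2 ≤ p) : 2 ≤ baseExponent d s p := by
  unfold baseExponent; split_ifs <;> linarith

lemma sub_div_eq (hd : 0 < d) (hp : 2 ≤ p) :
    ((d : ℝ) - s * p) / (p * d) = 1 / p - (s : ℝ) / d := by
  have hd0 : (0 : ℝ) < d := by exact_mod_cast hd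
  have hp0 : 0 < p := by linarith
  field_simp

lemma admissible_two_mul (hd : 0 < d) (hp : 2 ≤ p) (hpq : p ≤ 2 * q)
    (hs : 1 / p - 1 / (2 * (q : ℝ)) < (s : ℝ) / d) : AdmissibleExponent d s p (2 * q) := by
  have hp0 : 0 < p := by linarith
  have hq0 : (0 : ℝ) < 2 * q := by linarith
  refine ⟨hq0, max_lt ?_ (by positivity), le_max_of_le_left (one_div_le_one_div_of_le hp0 hpq)⟩
  rw [sub_div_eq hd hp]
  linarith

lemma admissible_baseExponent (hd : 0 < d) (hp : 2 ≤ p) (hs : 0 < s) :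
    AdmissibleExponent d s p (baseExponent d s p) := by
  have hp0 : 0 < p := by linarith
  have hd0 : (0 : ℝ) < d := by exact_mod_cast hd
  have hs0 : (0 : ℝ) < s := by exact_mod_cast hs
  have hsd : 0 < (s : ℝ) / d := by positivity
  have h2p : 1 / p ≤ 1 / 2 := one_div_le_one_div_of_le two_pos hp
  unfold AdmissibleExponent
  rw [sub_div_eq hd hp]
  unfold baseExponent
  split_ifs with h
  · refine ⟨two_pos, max_lt (by linarith) (by norm_num), le_max_of_le_right ?_⟩
    rw [indicator_of_mem (show (s : ℝ) ∈ {t : ℝ | (d : ℝ) / p < t} from h)]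
    norm_num
  · exact ⟨hp0, max_lt (by linarith) (by positivity), le_max_left _ _⟩

lemma smoothness_pos (hp : 2 ≤ p) (hpq : p ≤ 2 * q)
    (hs : 1 / p - 1 / (2 * (q : ℝ)) < (s : ℝ) / d) : 0 < s := by
  rcases Nat.eq_zero_or_pos s with h | h
  · have hp0 : 0 < p := by linarith
    have := one_div_le_one_div_of_le hp0 hpq
    simp only [h, Nat.cast_zero, zero_div] at hs
    linarith
  · exact h

/-- The exponent arithmetic behind the rate. -/
lemma rate_exponent_arith (hd : 0 < d) (hp : 2 ≤ p) {θ ε T : ℝ}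
    (hq : 1 ≤ q)
    (hθ0 : 0 ≤ θ)
    (hT : T = max (1 / p - (s : ℝ) / d) 0 + s * ε / d)
    (hθ : θ * (1 / baseExponent d s p - 1 / (2 * (q : ℝ))) ≤
      max 0 (((q : ℝ) - 1) * T + 1 / baseExponent d s p - 1 / 2)) (hε : 0 ≤ ε) :
    -((s : ℝ) / d) + θ * (1 / p - 1 / (2 * (q : ℝ))) ≤
      max ((q : ℝ) * (1 / p - (s : ℝ) / d) - 1 / 2) (-((s : ℝ) / d)) +
        ((q : ℝ) - 1) * (s * ε / d) := by
  have hp0 : 0 < p := by linarith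
  have hd0 : (0 : ℝ) < d := by exact_mod_cast hd
  have hq1 : (1 : ℝ) ≤ q := by exact_mod_cast hq
  have hη : 0 ≤ (s : ℝ) * ε / d := by positivity
  set η := (s : ℝ) * ε / d
  have hqη : 0 ≤ ((q : ℝ) - 1) * η := mul_nonneg (by linarith) hη
  have h2p : 1 / p ≤ 1 / 2 := one_div_le_one_div_of_le two_pos hp
  have hbase : 1 / p ≤ 1 / baseExponent d s p :=
    one_div_le_one_div_of_le (by linarith [two_le_baseExponent (d := d) (s := s) hp])
      (baseExponent_le hp)
  have h1 : θ * (1 / p - 1 / (2 * (q : ℝ))) ≤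
      θ * (1 / baseExponent d s p - 1 / (2 * (q : ℝ))) := by gcongr
  have h2 := h1.trans hθ
  have hm1 := le_max_left ((q : ℝ) * (1 / p - (s : ℝ) / d) - 1 / 2) (-((s : ℝ) / d))
  have hm2 := le_max_right ((q : ℝ) * (1 / p - (s : ℝ) / d) - 1 / 2) (-((s : ℝ) / d))
  -- If the Hölder excess is not positive, the exponent is at most `-s / d`. Otherwise `s > d / p`
  -- gives `T = η` and base exponent `2`, hence `-s / d` up to `(q - 1) η`; and `s ≤ d / p` gives `T
  -- = 1 / p - s / d + η` and base exponent `p`, hence the other branch up to `(q - 1) η`.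
  rcases le_max_iff.1 h2 with h | h
  · linarith
  · have hiff : (d : ℝ) / p < s ↔ 1 / p < (s : ℝ) / d := by
      rw [div_lt_iff₀ hp0, lt_div_iff₀ hd0, div_mul_eq_mul_div, div_lt_iff₀ hp0, one_mul]
    unfold baseExponent at h
    split_ifs at h with hc
    · rw [hiff] at hc
      rw [max_eq_right (by linarith)] at hT
      rw [hT] at h
      linarith
    · rw [hiff, not_lt] at hc
      rw [max_eq_left (by linarith)] at hT
      rw [hT] at h
      linarith

lemma rpow_half_le_rpow_double {m : ℕ} (hm : 1 ≤ m) (e : ℝ) :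
    (m : ℝ) ^ e = (2 : ℝ) ^ (-e) * ((m + m : ℕ) : ℝ) ^ e := by
  have hm0 : (0 : ℝ) < m := by exact_mod_cast hm
  push_cast
  rw [← two_mul, Real.mul_rpow two_pos.le hm0.le, ← mul_assoc, ← Real.rpow_add two_pos]
  simp

/-- The two-stage estimator is unbiased with the stated rate, for a factor `c` of the oracle rate
whose `r`-th powers are at most `D`. -/
theorem exists_twoStage_bound (hd : 0 < d) (hp : 2 ≤ p) (hqp : (q : ℝ) ≤ p) (hpq : p ≤ 2 * q)
    (hs : 1 / p - 1 / (2 * (q : ℝ)) < (s : ℝ) / d) (R : ℝ) (A k : ℝ → ℝ) :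
    ∃ C κ : ℝ, 0 ≤ C ∧ ∀ (b b' B D : ℝ) (c : ℝ → ℝ) (f p₀ pT : (Fin d → ℝ) → ℝ)
      (K : FunEstimator d), 0 < b → 1 ≤ B → InClass s p b b' B f p₀ pT → SobolevNormLE s p R f →
      IsSobolevEstimator s p K → OracleRate s p c A k f p₀ K → 1 ≤ D →
      (∀ r : ℝ, 2 ≤ r → r ≤ 2 * q → 0 ≤ c r ∧ c r ^ r ≤ D) → ∀ m : ℕ, 1 ≤ m →
      Integrable (fun x => twoStage q p₀ pT K m x (fun i => f (x i))) (sampleLaw p₀ (m + m)) ∧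
      ∫ x, twoStage q p₀ pT K m x (fun i => f (x i)) ∂(sampleLaw p₀ (m + m)) = moment q pT f ∧
      ∫ x, |twoStage q p₀ pT K m x (fun i => f (x i)) - moment q pT f|
        ∂(sampleLaw p₀ (m + m)) ≤ C * (1 + Real.log ((m + m : ℕ) : ℝ)) ^ κ *
          (B * √(b' * D) * ((m + m : ℕ) : ℝ) ^ rateExponent d s q p) := by
  have hp0 : 0 < p := by linarith
  have hd0 : (0 : ℝ) < d := by exact_mod_cast hd
  have hs0 := smoothness_pos hp hpq hs
  have hs0' : (0 : ℝ) < s := by exact_mod_cast hs0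
  have hq1' : (1 : ℝ) ≤ q := by linarith
  have hq1 : 1 ≤ q := by exact_mod_cast hq1'
  have hq0 : (0 : ℝ) < q := by linarith
  have hp2q : 1 / (2 * (q : ℝ)) ≤ 1 / p := one_div_le_one_div_of_le hp0 hpq
  obtain ⟨CS, hCS1, hCS⟩ := exists_eLpNorm_le_of_hasWeakDerivsLE hd
  set r₀ := baseExponent d s p with hr₀
  have hr₀2 : 2 ≤ r₀ := two_le_baseExponent hp
  have hr₀p : r₀ ≤ p := baseExponent_le hp
  obtain ⟨kb, hkb⟩ := exists_nat_ge (max (k r₀) (k (2 * q)))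
  set Ab := max 1 (max (A r₀) (A (2 * q))) with hAb
  have hAb1 : 1 ≤ Ab := le_max_left _ _
  -- For `ε ≤ ε₀` the loss `s ε / d` fits between the critical value and `1 / (2q)`, so that `T ≤ 1
  -- / (2q)`.
  set ε₀ := min 1 ((1 / (2 * (q : ℝ)) - max (1 / p - (s : ℝ) / d) 0) * d / s) with hε₀
  have hgap : 0 < 1 / (2 * (q : ℝ)) - max (1 / p - (s : ℝ) / d) 0 :=
    sub_pos.2 (max_lt (by linarith) (by positivity))
  have hε₀0 : 0 < ε₀ := lt_min one_pos (by positivity)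
  have hε₀1 : ε₀ ≤ 1 := min_le_left _ _
  set R' := max R 0 with hR'
  have hR0 : 0 ≤ R' := le_max_right _ _
  set M := Real.exp (((q : ℝ) - 1) * s / d) with hM
  set E := max ((q : ℝ) * (1 / p - (s : ℝ) / d) - 1 / 2) (-((s : ℝ) / d)) with hE
  have hrate : rateExponent d s q p = E - 1 / 2 := by
    rw [rateExponent, hE, ← max_sub_sub_right]
    congr 1 <;> ring
  set G := ((CS / ε₀) ^ s * R') ^ (q - 1) * M + 1 with hG
  have hG0 : 0 ≤ G := by positivity
  set C₁ := 2 * ((q : ℝ) * 2 ^ q) * Ab ^ q * G * (2 : ℝ) ^ (-(E - 1 / 2)) with hC₁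
  have hC₁0 : 0 ≤ C₁ := by positivity
  refine ⟨C₁, ((kb * q + s * (q - 1) : ℕ) : ℝ), hC₁0, ?_⟩
  intro b b' B D c f p₀ pT K hb hB hclass hnorm hKs horacle hD hcD m hm
  obtain ⟨hfS, hp₀, hpT, hbd, hw⟩ := hclass
  have hm0 : (0 : ℝ) < m := by exact_mod_cast hm
  have hm1 : (1 : ℝ) ≤ m := by exact_mod_cast hm
  have hb' : 1 ≤ b' := hp₀.one_le_of_le fun x hx => (hbd x hx).2
  set Λ := 1 + Real.log m with hΛ
  have hΛ1 : 1 ≤ Λ := by linarith [Real.log_nonneg hm1]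
  have hΛ0 : 0 < Λ := by linarith
  set U := Ab * Λ ^ kb with hU
  have hU1 : 1 ≤ U := one_le_mul_of_one_le_of_one_le hAb1 (one_le_pow₀ hΛ1)
  have hAU : ∀ r, A r ≤ Ab → k r ≤ kb → A r * Λ ^ (k r) ≤ U := by
    intro r h1 h2
    calc A r * Λ ^ (k r) ≤ Ab * Λ ^ (k r) := by gcongr
      _ ≤ Ab * Λ ^ (kb : ℝ) := by gcongr
      _ = U := by rw [Real.rpow_natCast]
  -- The distance to the critical exponent shrinks like `1 / (1 + log m)`: the power of `m` then
  -- loses at most a constant, and the embedding constant grows like `Λ ^ s`.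
  set ε := ε₀ / Λ with hε
  have hε0 : 0 < ε := by positivity
  have hεle : ε ≤ ε₀ := div_le_self hε₀0.le hΛ1
  have hε1 : ε ≤ 1 := hεle.trans hε₀1
  obtain ⟨T, hT⟩ : ∃ T, T = max (1 / p - (s : ℝ) / d) 0 + s * ε / d := ⟨_, rfl⟩
  have hTle : T ≤ 1 / (2 * q) := by
    have h1 : ε ≤ (1 / (2 * (q : ℝ)) - max (1 / p - (s : ℝ) / d) 0) * d / s :=
      hεle.trans (min_le_right _ _)
    rw [le_div_iff₀ hs0'] at h1
    have h2 : (s : ℝ) * ε / d ≤ 1 / (2 * (q : ℝ)) - max (1 / p - (s : ℝ) / d) 0 := by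
      rw [div_le_iff₀ hd0]; linarith
    linarith
  have hT0 : 0 < T := by
    have := le_max_right (1 / p - (s : ℝ) / d) 0
    have : 0 < (s : ℝ) * ε / d := by positivity
    linarith
  obtain ⟨β, θ, hTβ, hβq, hθ0, hθ1, hhold, hθ⟩ :=
    exists_holder_exponents hq1' hr₀2 (hr₀p.trans hpq) hTle
  have hβ0 : 0 < β := hT0.trans_le hTβ
  have harith := rate_exponent_arith hd hp hq1 hθ0 hT hθ hε0.le
  set f₀ := hfS.1.1.mk f with hf₀
  have hff₀ : f =ᵐ[cubeMeasure d] f₀ := hfS.1.1.ae_eq_mk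
  have hf₀m : Measurable f₀ := hfS.1.1.stronglyMeasurable_mk.measurable
  have hpβ : p ≤ 1 / β := by
    rw [le_one_div hp0 hβ0]; exact hβq.trans hp2q
  have hfΦ : eLpNorm f₀ (ENNReal.ofReal (1 / β)) (cubeMeasure d) ≤
      ENNReal.ofReal ((CS / ε) ^ s * R') := by
    rw [← eLpNorm_congr_ae hff₀]
    have hwd := hnorm.hasWeakDerivsLE
    refine hCS s p (1 / β) ε R' (by linarith) hpβ hε0 hε1 ?_ hR0 f ?_
    · rw [one_div_one_div]
      have := le_max_left (1 / p - (s : ℝ) / d) 0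
      have e1 : (s : ℝ) * (1 - ε) / d = (s : ℝ) / d - s * ε / d := by ring
      linarith
    · obtain ⟨Gα, h0, h1⟩ := hwd
      exact ⟨Gα, h0, fun α hα => ⟨(h1 α hα).1, (h1 α hα).2.1,
        (h1 α hα).2.2.trans (ENNReal.ofReal_le_ofReal (le_max_left _ _))⟩⟩
  -- `q ≤ p` and the finite measure of the cube place `f₀` in `L^q`.
  have hfq : Integrable (fun z => f₀ z ^ q) (cubeMeasure d) := by
    have h1 : MemLp f₀ (q : ENNReal) (cubeMeasure d) := by
      refine ((memLp_congr_ae hff₀).1 hfS.1).mono_exponent ?_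
      rw [← ENNReal.ofReal_natCast]
      exact ENNReal.ofReal_le_ofReal hqp
    refine (integrable_norm_iff (hf₀m.pow_const q).aestronglyMeasurable).1 ?_
    simp_rw [norm_pow]
    exact h1.integrable_norm_pow'
  have hKm := (hKs m hm).2
  set e₁ := -((s : ℝ) / d) + max (1 / p - 1 / (2 * (q : ℝ))) 0 with he₁
  have he₁' : e₁ = -((s : ℝ) / d) + (1 / p - 1 / (2 * (q : ℝ))) := by
    rw [he₁, max_eq_left (by linarith)]
  have hX₀ := horacle.lintegral_le hp₀ hff₀ hm (admissible_baseExponent hd hp hs0)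
    (hAU r₀ ((le_max_left _ _).trans (le_max_right _ _)) ((le_max_left _ _).trans hkb))
    (by linarith) (hcD r₀ hr₀2 (hr₀p.trans hpq)).1 (hcD r₀ hr₀2 (hr₀p.trans hpq)).2
  have hX₁ := horacle.lintegral_le hp₀ hff₀ hm (admissible_two_mul hd hp hpq hs)
    (hAU (2 * q) ((le_max_right _ _).trans (le_max_right _ _)) ((le_max_right _ _).trans hkb))
    (by linarith) (hcD (2 * q) (by linarith) le_rfl).1 (hcD (2 * q) (by linarith) le_rfl).2
  have hr₀inv : 1 / p - 1 / r₀ ≤ 0 := by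
    have := one_div_le_one_div_of_le (by linarith) hr₀p
    linarith
  rw [← hr₀, max_eq_right hr₀inv, add_zero] at hX₀
  have hprob := hp₀.isProbabilityMeasure
  have : IsProbabilityMeasure (sampleLaw p₀ m) := by unfold sampleLaw; infer_instance
  have hF : Measurable (Function.uncurry fun x z => K m x (fun i => f₀ (x i)) z) := by
    refine hKm.comp (measurable_fst.prodMk (Measurable.prodMk ?_ measurable_snd))
    exact measurable_pi_iff.2 fun i => hf₀m.comp ((measurable_pi_apply i).comp measurable_fst)
  have hr₀0 : 0 < r₀ := by linarith
  have ha₁ : r₀ * (2 * (1 - θ) / r₀) = 2 * (1 - θ) := by field_simp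
  have ha₂ : 2 * (q : ℝ) * (θ / q) = 2 * θ := by field_simp
  have hsum : 2 * ((q : ℝ) - 1) * β + 2 * (1 - θ) / r₀ + θ / q = 1 := hhold
  have h1θ : 0 ≤ 1 - θ := by linarith
  have ha₀nn : 0 ≤ 2 * ((q : ℝ) - 1) * β := by
    have : 0 ≤ (q : ℝ) - 1 := by linarith
    positivity
  have hΦ0 : 0 ≤ (CS / ε) ^ s * R' := by positivity
  have hS := lintegral_pow_sub_pow_sq_le (P := sampleLaw p₀ m) hq1 hf₀m hF
    (a₀ := 2 * ((q : ℝ) - 1) * β) (a₁ := 2 * (1 - θ) / r₀) (a₂ := θ / q) ha₀nn (by positivity)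
    (by positivity) (by positivity : 0 < 1 / β) hr₀0.le hsum (by field_simp)
    (by rw [ha₁, ha₂]; ring) hΦ0 (by positivity) (by positivity) hfΦ hX₀ hX₁
  obtain ⟨hI, hUnb, herr⟩ := twoStage_estimates hm hb hB hp₀ hpT hbd hw hff₀ hf₀m hfq hKm hS
  refine ⟨hI, hUnb, herr.trans ?_⟩
  have hZ := weighted_moment_bound_le hm (r₀ := r₀) (r₁ := 2 * q) (a₁ := 2 * (1 - θ) / r₀)
    (a₂ := θ / q) (e₀ := -((s : ℝ) / d)) (e₁ := e₁) (E := 2 * E) (M := M ^ 2) hD hU1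
    (by linarith) (by rw [ha₁, ha₂]; ring) (by
      rw [ha₁, ha₂]
      have hexp : -((s : ℝ) / d) * (2 * (1 - θ)) + e₁ * (2 * θ) ≤
          2 * E + 2 * (((q : ℝ) - 1) * (s * ε / d)) := by
        rw [he₁']; linarith
      calc _ ≤ (m : ℝ) ^ (2 * E + 2 * (((q : ℝ) - 1) * (s * ε / d))) :=
            Real.rpow_le_rpow_of_exponent_le hm1 hexp
        _ = (m : ℝ) ^ (2 * E) * (m : ℝ) ^ (2 * (((q : ℝ) - 1) * (s * ε / d))) :=
            Real.rpow_add hm0 _ _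
        _ ≤ (m : ℝ) ^ (2 * E) * M ^ 2 := by
            gcongr
            rw [hM, ← Real.exp_nat_mul]
            have hq1nn : 0 ≤ (q : ℝ) - 1 := by linarith
            refine rpow_div_one_add_log_le hm (by positivity) ?_
            rw [← hΛ, hε]
            calc 2 * (((q : ℝ) - 1) * (s * (ε₀ / Λ) / d)) =
                  ε₀ * (2 * (((q : ℝ) - 1) * s / d) / Λ) := by ring
              _ ≤ 1 * (2 * (((q : ℝ) - 1) * s / d) / Λ) := by gcongr
              _ = _ := by push_cast; ring)
  have hY : D * (U * (m : ℝ) ^ e₁) ^ (2 * (q : ℝ)) ≤ D * U ^ (2 * q) * (m : ℝ) ^ (2 * E) := by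
    have h2q : (2 * (q : ℝ)) = ((2 * q : ℕ) : ℝ) := by push_cast; ring
    rw [Real.mul_rpow (by linarith) (by positivity), ← Real.rpow_mul hm0.le, mul_assoc]
    -- The error at `r = 2q` has exactly twice the first branch of `E` as its exponent.
    have hexp : e₁ * (2 * (q : ℝ)) ≤ 2 * E := by
      have h1 := le_max_left ((q : ℝ) * (1 / p - (s : ℝ) / d) - 1 / 2) (-((s : ℝ) / d))
      have h2 : e₁ * (2 * (q : ℝ)) = 2 * ((q : ℝ) * (1 / p - (s : ℝ) / d) - 1 / 2) := by
        rw [he₁']; field_simp; ring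
      rw [h2]; linarith
    have h3 : U ^ (2 * (q : ℝ)) = U ^ (2 * q) := by rw [h2q, Real.rpow_natCast]
    rw [h3]
    gcongr
  refine (sqrt_error_le hm hq1 (by linarith) (by linarith) (by linarith) hU1 hΦ0
    (Real.exp_nonneg _) (by positivity) hZ hY).trans ?_
  have hLam : Λ ≤ 1 + Real.log ((m + m : ℕ) : ℝ) := by
    have : Real.log m ≤ Real.log ((m + m : ℕ) : ℝ) :=
      Real.log_le_log hm0 (by push_cast; linarith)
    linarith
  have hΦΛ : ((CS / ε) ^ s * R') ^ (q - 1) * M + 1 ≤ Λ ^ (s * (q - 1)) * G := by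
    have e1 : (CS / ε) ^ s * R' = Λ ^ s * ((CS / ε₀) ^ s * R') := by
      rw [hε, show CS / (ε₀ / Λ) = Λ * (CS / ε₀) by field_simp, mul_pow]; ring
    rw [e1, mul_pow, ← pow_mul, hG]
    have : (1 : ℝ) ≤ Λ ^ (s * (q - 1)) := one_le_pow₀ hΛ1
    linarith
  have hUq : U ^ q = Ab ^ q * Λ ^ (kb * q) := by rw [hU, mul_pow, ← pow_mul]
  rw [hrate, rpow_half_le_rpow_double hm (E - 1 / 2), Real.rpow_natCast]
  calc _ ≤ 2 * ((q : ℝ) * 2 ^ q) * U ^ q * (Λ ^ (s * (q - 1)) * G) *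
        (B * √(b' * D) * ((2 : ℝ) ^ (-(E - 1 / 2)) * ((m + m : ℕ) : ℝ) ^ (E - 1 / 2))) := by
        gcongr
    _ = C₁ * Λ ^ (kb * q + s * (q - 1)) *
        (B * √(b' * D) * ((m + m : ℕ) : ℝ) ^ (E - 1 / 2)) := by
        rw [hUq, hC₁, pow_add]; ring
    _ ≤ _ := mul_le_mul_of_nonneg_right (mul_le_mul_of_nonneg_left
        (pow_le_pow_left₀ hΛ0.le hLam _) hC₁0) (by positivity)

end Assembly

end CovShift

end

/-! ### The two forms of the oracle factor. -/

theorem theorem2 (d s q : ℕ) (p : ℝ) (hd : 0 < d) (hp : 2 ≤ p) (hqp : (q : ℝ) ≤ p)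
    (hpq : p ≤ 2 * q) (hs : 1 / p - 1 / (2 * (q : ℝ)) < (s : ℝ) / d)
    (R : ℝ) (A k : ℝ → ℝ) :
    -- the oracle rate with the factor `b'`; constants are allowed to depend on `b'`
    (∀ b' : ℝ, ∃ C κ : ℝ, ∀ (b B : ℝ) (f p₀ pT : (Fin d → ℝ) → ℝ) (K : CovShift.FunEstimator d),
      0 < b → 1 ≤ B → CovShift.InClass s p b b' B f p₀ pT → CovShift.SobolevNormLE s p R f →
      CovShift.IsSobolevEstimator s p K →
      CovShift.OracleRate s p (fun _ => b') A k f p₀ K →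
      ∀ m : ℕ, 1 ≤ m → CovShift.UnbiasedWithRate s q p b' B C κ f p₀ pT K m) ∧
    -- the oracle rate with the factor `b'` on the `r`-th moment; constants do not depend on `b'`
    (∃ C κ : ℝ, ∀ (b b' B : ℝ) (f p₀ pT : (Fin d → ℝ) → ℝ) (K : CovShift.FunEstimator d),
      0 < b → 1 ≤ B → CovShift.InClass s p b b' B f p₀ pT → CovShift.SobolevNormLE s p R f →
      CovShift.IsSobolevEstimator s p K →
      CovShift.OracleRate s p (fun r => b' ^ (1 / r)) A k f p₀ K →
      ∀ m : ℕ, 1 ≤ m → CovShift.UnbiasedWithRate s q p b' B C κ f p₀ pT K m) := by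
  obtain ⟨C, κ, hC, h⟩ := CovShift.exists_twoStage_bound hd hp hqp hpq hs R A k
  constructor
  · intro b'
    -- For the factor `b'`, the powers `b' ^ r` with `r ≤ 2q` are at most `D = b' ^ (2q)`, as `b' ≥
    -- 1`. The square root of `b' * D` then leaves a surplus of at most `b' ^ q` beyond the
    -- displayed `b'`.
    refine ⟨C * b' ^ q, κ, ?_⟩
    intro b B f p₀ pT K hb hB hclass hnorm hKs horacle m hm
    have hb' : 1 ≤ b' := hclass.2.1.one_le_of_le fun x hx => (hclass.2.2.2.1 x hx).2
    obtain ⟨h1, h2, h3⟩ := h b b' B (b' ^ (2 * q)) (fun _ => b') f p₀ pT K hb hB hclass hnorm hKs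
      horacle (one_le_pow₀ hb') (fun r _ hr => ⟨by linarith, by
        rw [← Real.rpow_natCast]
        refine Real.rpow_le_rpow_of_exponent_le hb' ?_
        push_cast
        exact hr⟩) m hm
    refine ⟨h1, h2, h3.trans ?_⟩
    have hlog : 0 ≤ 1 + Real.log ((m + m : ℕ) : ℝ) := by
      have : (1 : ℝ) ≤ ((m + m : ℕ) : ℝ) := by exact_mod_cast (by omega : 1 ≤ m + m)
      linarith [Real.log_nonneg this]
    have hsq : √(b' * b' ^ (2 * q)) ≤ b' ^ q * b' := by
      rw [Real.sqrt_le_iff]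
      refine ⟨by positivity, ?_⟩
      calc b' * b' ^ (2 * q) ≤ b' * b' ^ (2 * q) * b' :=
            le_mul_of_one_le_right (by positivity) hb'
        _ = _ := by ring
    calc _ ≤ C * (1 + Real.log ((m + m : ℕ) : ℝ)) ^ κ * (B * (b' ^ q * b') *
          ((m + m : ℕ) : ℝ) ^ CovShift.rateExponent d s q p) := by gcongr
      _ = _ := by ring
  · refine ⟨C, κ, ?_⟩
    intro b b' B f p₀ pT K hb hB hclass hnorm hKs horacle m hm
    have hb' : 1 ≤ b' := hclass.2.1.one_le_of_le fun x hx => (hclass.2.2.2.1 x hx).2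
    have hb0 : 0 ≤ b' := by linarith
    -- The `r`-th power of this factor is `b'` for every `r`, so `D = b'`, and the square root of
    -- `b' * D` is the displayed `b'` without surplus.
    obtain ⟨h1, h2, h3⟩ := h b b' B b' (fun r => b' ^ (1 / r)) f p₀ pT K hb hB hclass hnorm hKs
      horacle hb' (fun r hr _ => ⟨by positivity, by
        rw [← Real.rpow_mul hb0, one_div_mul_cancel (by linarith), Real.rpow_one]⟩) m hm
    rw [Real.sqrt_mul_self hb0] at h3
    exact ⟨h1, h2, h3⟩
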